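/- Let $\mathcal X_1,\mathcal X_2$ be finite sets, let $(X_1,X_2)$ and $(K_1,K_2)$ be pairs of random variables with values in $\mathcal X_1\times\mathcal X_2$ and laws $p_{X_1X_2}$, $p_{K_1K_2}$, and let $(X_1^n,X_2^n)$ and $(K_1^n,K_2^n)$ be $n$ i.i.d. copies of them, the keys $(K_1^n,K_2^n)$ being independent of the sources $(X_1^n,X_2^n)$. All logarithms are to base $2$; $H$ and $I$ are Shannon entropy and mutual information. A distributed encryption system of block length $n$ consists of finite sets $\mathcal C_1,\mathcal C_2$, encryption maps $\Phi_i:\mathcal X_i^n\times\mathcal X_i^n\to\mathcal C_i$ and a decryption map $\Psi:\mathcal X_1^n\times\mathcal X_2^n\times\mathcal C_1\times\mathcal C_2\to\mathcal X_1^n\times\mathcal X_2^n$, for which there is a distributed source code ($\phi_i:\mathcal X_i^n\to\mathcal M_i$, $\psi:\mathcal M_1\times\mathcal M_2\to\mathcal X_1^n\times\mathcal X_2^n$ with $\mathcal M_1,\mathcal M_2$ finite) such that $$\Psi(k_1,k_2,\Phi_1(k_1,x_1),\Phi_2(k_2,x_2))=\psi(\phi_1(x_1),\phi_2(x_2))\quad\text{for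 all }k_1,k_2,x_1,x_2 .$$ Its ciphertexts are $C_i=\Phi_i(K_i^n,X_i^n)$ and its error probability is $p_{\rm e}=\Pr[\psi(\phi_1(X_1^n),\phi_2(X_2^n))\ne(X_1^n,X_2^n)]$. A pair $(R_1,R_2)\in\mathbb R^2$ belongs to $\mathcal R^*(\varepsilon,\delta)$ if there is a sequence of such systems, one for each block length $n$, such that for every $\gamma>0$ and all sufficiently large $n$: $\frac1n\log|\mathcal C_i|\le R_i+\gamma$ for $i=1,2$, $p_{\rm e}\le\varepsilon$, and $I(C_1C_2;X_1^nX_2^n)\le\delta$. Fix $\delta_0>0$ and put $\mathcal R^*=\bigcap_{\varepsilon\in(0,1),\,\delta\in(0,\delta_0]}\mathcal R^*(\varepsilon,\delta)$. Let $$\mathcal R_{\rm sw}=\{R_1\ge H(X_1|X_2),\ R_2\ge H(X_2|X_1),\ R_1+R_2\ge H(X_1X_2)\},$$ $$\mathcal R_{\rm key}=\{R_1\le H(K_1),\ R_2\le H(K_2),\ R_1+R_2\le H(K_1K_2)\},$$ let the inner bound $\mathcal R$ be the set of all $(R_1,R_2)$ with $R_i\ge\widetilde R_i$ $(i=1,2)$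 for some $(\widetilde R_1,\widetilde R_2)\in\mathcal R_{\rm key}\cap\mathcal R_{\rm sw}$, and let the outer bound $\mathcal R^{(\rm out)}$ be $\mathcal R_{\rm sw}$ if $\mathcal R_{\rm key}\cap\mathcal R_{\rm sw}\ne\emptyset$ and $\emptyset$ otherwise. Assume that $H(X_i)\le H(K_i)$ for $i=1,2$. Then: (a) $\mathcal R=\mathcal R^{(\rm out)}$, and $\mathcal R^*(\varepsilon,\delta)\subseteq\mathcal R^{(\rm out)}$ for all $(\varepsilon,\delta)\in(0,1)\times[0,\delta_0]$. (b) If moreover $H(X_1|X_2)<H(K_1)$, $H(X_2|X_1)<H(K_2)$ and $H(X_1X_2)\ne H(K_1K_2)$, then for all $(\varepsilon,\delta)\in(0,1)\times(0,\delta_0]$ $$\mathcal R=\mathcal R^*=\mathcal R^*(\varepsilon,\delta)=\mathcal R^{(\rm out)} .$$ -/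

import Mathlib

/-! ### Entropies of laws on finite sets (base-two logarithms)

A probability law on a finite set `α` is a real function on `α` that lies in `stdSimplex ℝ α`. -/

/-- Shannon entropy `H(p) = -∑ p(a) log₂ p(a)`, with `0 log 0 = 0`. -/
noncomputable def entropy {α : Type*} [Fintype α] (p : α → ℝ) : ℝ :=
  -∑ a, p a * Real.logb 2 (p a)

/-- The law of the first component. -/
noncomputable def marg₁ {α β : Type*} [Fintype β] (p : α × β → ℝ) (a : α) : ℝ :=
  ∑ b, p (a, b)

/-- The law of the second component. -/
noncomputable def marg₂ {α β : Type*} [Fintype α] (p : α × β → ℝ) (b : β) : ℝ :=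
  ∑ a, p (a, b)

/-- `H(A | B) = -∑ p(a, b) log₂ p(a | b)` for `(A, B)` with law `p`. -/
noncomputable def condEntropy₁ {α β : Type*} [Fintype α] [Fintype β] (p : α × β → ℝ) : ℝ :=
  -∑ a, ∑ b, p (a, b) * Real.logb 2 (p (a, b) / marg₂ p b)

/-- `H(B | A) = -∑ p(a, b) log₂ p(b | a)` for `(A, B)` with law `p`. -/
noncomputable def condEntropy₂ {α β : Type*} [Fintype α] [Fintype β] (p : α × β → ℝ) : ℝ :=
  -∑ a, ∑ b, p (a, b) * Real.logb 2 (p (a, b) / marg₁ p a)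

/-- `I(A ; B) = ∑ p(a, b) log₂ (p(a, b) / (p(a) p(b)))` for `(A, B)` with law `p`. -/
noncomputable def mutualInfo {α β : Type*} [Fintype α] [Fintype β] (p : α × β → ℝ) : ℝ :=
  ∑ a, ∑ b, p (a, b) * Real.logb 2 (p (a, b) / (marg₁ p a * marg₂ p b))

/-- The law of `n` letters of the memoryless source with single-letter law `p`. -/
noncomputable def iidLaw {X₁ X₂ : Type*} (p : X₁ × X₂ → ℝ) (n : ℕ) :
    (Fin n → X₁) × (Fin n → X₂) → ℝ :=
  fun x => ∏ t, p (x.1 t, x.2 t)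

/-! ### Distributed source coding without and with encryption -/

/-- A distributed source code of block length `n`; the message set of terminal `i` is `Fin Mᵢ`. -/
structure SourceCode (X₁ X₂ : Type*) (n : ℕ) where
  M₁ : ℕ
  M₂ : ℕ
  φ₁ : (Fin n → X₁) → Fin M₁
  φ₂ : (Fin n → X₂) → Fin M₂
  ψ : Fin M₁ → Fin M₂ → (Fin n → X₁) × (Fin n → X₂)

/-- The set `𝒟` of source sequences that are decoded correctly. -/
def SourceCode.correctSet {X₁ X₂ : Type*} {n : ℕ} (S : SourceCode X₁ X₂ n) :
    Set ((Fin n → X₁) × (Fin n → X₂)) :=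
  {x | S.ψ (S.φ₁ x.1) (S.φ₂ x.2) = x}

open Classical in
/-- The error probability `Pr[(X₁ⁿ, X₂ⁿ) ∉ 𝒟]` for the memoryless source with law `pX`. -/
noncomputable def SourceCode.errProb {X₁ X₂ : Type*} [Fintype X₁] [Fintype X₂] {n : ℕ}
    (S : SourceCode X₁ X₂ n) (pX : X₁ × X₂ → ℝ) : ℝ :=
  ∑ x, if x ∈ S.correctSet then 0 else iidLaw pX n x

/-- A distributed encryption system of block length `n`; the ciphertext set of terminal `i`
is `Fin Nᵢ`, and `Φᵢ k x` is the ciphertext of the source sequence `x` under the key `k`. -/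
structure Cryptosystem (X₁ X₂ : Type*) (n : ℕ) where
  N₁ : ℕ
  N₂ : ℕ
  Φ₁ : (Fin n → X₁) → (Fin n → X₁) → Fin N₁
  Φ₂ : (Fin n → X₂) → (Fin n → X₂) → Fin N₂
  Ψ : (Fin n → X₁) → (Fin n → X₂) → Fin N₁ → Fin N₂ → (Fin n → X₁) × (Fin n → X₂)

/-- Whatever the keys are, encryption followed by decryption acts on the source sequences as the
distributed source code `S` does. -/
def Cryptosystem.ActsAs {X₁ X₂ : Type*} {n : ℕ} (E : Cryptosystem X₁ X₂ n)
    (S : SourceCode X₁ X₂ n) : Prop :=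
  ∀ k₁ k₂ x₁ x₂, E.Ψ k₁ k₂ (E.Φ₁ k₁ x₁) (E.Φ₂ k₂ x₂) = S.ψ (S.φ₁ x₁) (S.φ₂ x₂)

open Classical in
/-- The joint law of the ciphertexts `(C₁, C₂)` and the sources `(X₁ⁿ, X₂ⁿ)`, where
`Cᵢ = Φᵢ(Kᵢⁿ, Xᵢⁿ)` and the keys `(K₁ⁿ, K₂ⁿ)` are independent of the sources. -/
noncomputable def Cryptosystem.jointLaw {X₁ X₂ : Type*} [Fintype X₁] [Fintype X₂] {n : ℕ}
    (E : Cryptosystem X₁ X₂ n) (pX pK : X₁ × X₂ → ℝ) :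
    (Fin E.N₁ × Fin E.N₂) × ((Fin n → X₁) × (Fin n → X₂)) → ℝ :=
  fun cx => ∑ k : (Fin n → X₁) × (Fin n → X₂),
    if (E.Φ₁ k.1 cx.2.1, E.Φ₂ k.2 cx.2.2) = cx.1 then iidLaw pX n cx.2 * iidLaw pK n k else 0

/-- The leakage `I(C₁ C₂ ; X₁ⁿ X₂ⁿ)`. -/
noncomputable def Cryptosystem.leakage {X₁ X₂ : Type*} [Fintype X₁] [Fintype X₂] {n : ℕ}
    (E : Cryptosystem X₁ X₂ n) (pX pK : X₁ × X₂ → ℝ) : ℝ :=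
  mutualInfo (E.jointLaw pX pK)

/-! ### Rate regions -/

/-- `R` is an `(ε, δ)`-reliable and secure rate pair. -/
def IsReliableSecure {X₁ X₂ : Type*} [Fintype X₁] [Fintype X₂] (pX pK : X₁ × X₂ → ℝ)
    (ε δ : ℝ) (R : ℝ × ℝ) : Prop :=
  ∃ (E : ∀ n, Cryptosystem X₁ X₂ n) (S : ∀ n, SourceCode X₁ X₂ n),
    (∀ n, (E n).ActsAs (S n)) ∧
    ∀ γ > 0, ∃ n₀ : ℕ, ∀ n : ℕ, n₀ ≤ n →
      1 / (n : ℝ) * Real.logb 2 ((E n).N₁ : ℝ) ≤ R.1 + γ ∧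
      1 / (n : ℝ) * Real.logb 2 ((E n).N₂ : ℝ) ≤ R.2 + γ ∧
      (S n).errProb pX ≤ ε ∧
      (E n).leakage pX pK ≤ δ

/-- The `(ε, δ)`-reliable and secure rate region `ℛ*(ε, δ)`. -/
def epsDeltaRegion {X₁ X₂ : Type*} [Fintype X₁] [Fintype X₂] (pX pK : X₁ × X₂ → ℝ)
    (ε δ : ℝ) : Set (ℝ × ℝ) :=
  {R | IsReliableSecure pX pK ε δ R}

/-- The reliable and secure rate region `ℛ*`, the intersection of all `ℛ*(ε, δ)` with
`ε ∈ (0, 1)` and `δ ∈ (0, δ₀]`. -/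
def reliableSecureRegion {X₁ X₂ : Type*} [Fintype X₁] [Fintype X₂] (pX pK : X₁ × X₂ → ℝ)
    (δ₀ : ℝ) : Set (ℝ × ℝ) :=
  ⋂ ε ∈ Set.Ioo (0 : ℝ) 1, ⋂ δ ∈ Set.Ioc (0 : ℝ) δ₀, epsDeltaRegion pX pK ε δ

/-- The Slepian-Wolf region of the sources. -/
def swRegion {X₁ X₂ : Type*} [Fintype X₁] [Fintype X₂] (pX : X₁ × X₂ → ℝ) : Set (ℝ × ℝ) :=
  {R | condEntropy₁ pX ≤ R.1 ∧ condEntropy₂ pX ≤ R.2 ∧ entropy pX ≤ R.1 + R.2}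

/-- The key region. -/
def keyRegion {X₁ X₂ : Type*} [Fintype X₁] [Fintype X₂] (pK : X₁ × X₂ → ℝ) : Set (ℝ × ℝ) :=
  {R | R.1 ≤ entropy (marg₁ pK) ∧ R.2 ≤ entropy (marg₂ pK) ∧ R.1 + R.2 ≤ entropy pK}

/-- The inner bound `ℛ`: all pairs that dominate a pair in the key and Slepian-Wolf regions. -/
def innerRegion {X₁ X₂ : Type*} [Fintype X₁] [Fintype X₂] (pX pK : X₁ × X₂ → ℝ) :
    Set (ℝ × ℝ) :=
  {R | ∃ R' ∈ keyRegion pK ∩ swRegion pX, R'.1 ≤ R.1 ∧ R'.2 ≤ R.2}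

open Classical in
/-- The outer bound `ℛ^(out)`: the Slepian-Wolf region if it meets the key region, and otherwise
the empty set. -/
noncomputable def outerRegion {X₁ X₂ : Type*} [Fintype X₁] [Fintype X₂]
    (pX pK : X₁ × X₂ → ℝ) : Set (ℝ × ℝ) :=
  if (keyRegion pK ∩ swRegion pX).Nonempty then swRegion pX else ∅

/-! The inner and outer bounds coincide for an elementary reason: if `H(Xᵢ) ≤ H(Kᵢ)` and
`H(X₁X₂) ≤ H(K₁K₂)`, each pair of the Slepian–Wolf region dominates a pair on the face
`R₁ + R₂ = H(X₁X₂)` with `Rᵢ ≤ H(Xᵢ)`, and that pair lies in the key region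
(`mem_innerRegion_of_mem_swRegion`). It remains to prove a strong converse and achievability.

*Converse.* With the keys fixed, a cryptosystem is a source code, so the set of correctly decoded
pairs has at most `|𝒞₁||𝒞₂|` elements, and at most `|𝒞ᵢ|` in each fiber. Comparing these counts with
the concentration of the (conditional) information densities gives the Slepian–Wolf bounds for every
error probability below one (`mem_swRegion_of_isReliableSecure`). For the keys, a ciphertext together
with the typical keys leaves about `2 ^ (n H(K₁K₂))` candidates for the sources. If this is
exponentially smaller than `2 ^ (n H(X₁X₂))`, an independent source pair is among the candidates only
with exponentially small probability, while the actual one is with probability bounded away from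
zero; by a change of measure the leakage then grows linearly in `n` (`le_leakage`,
`entropy_le_of_isReliableSecure`).

*Achievability.* Terminal `i` sends `φᵢ(xᵢ) + κᵢ(kᵢ)` in `ℤ / Mᵢ`, where `φ₁, φ₂` form a Slepian–Wolf
code and `κ₁, κ₂` hash the keys; all four come from random functions. The leakage is at most the
divergence of the hash values from the uniform law (`mutualInfo_masked_le`). Its mean over the hash
functions is, by concavity of the logarithm, at most
`∑ P(k) log (1 + M₁ M₂ P(k) + M₁ P₁(k₁) + M₂ P₂(k₂))` (`exists_hash`), which decays exponentially at
rates inside the key region (`eventually_exists_hash`); a bound of order `o(n)` would not suffice,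
because the leakage is not normalized. Points of the boundary are reached through interior rates and
a diagonal sequence (`isReliableSecure_of_forall`).

The bounds on tail probabilities and on the divergence of the hash values all follow from the
exponential estimate `tendsto_sum_iidLaw_mul_log`. -/

/-! ### Marginals and memoryless laws -/

theorem marg₂_nonneg {α β : Type*} [Fintype α] {p : α × β → ℝ} (hp : ∀ x, 0 ≤ p x) (b : β) :
    0 ≤ marg₂ p b :=
  Finset.sum_nonneg fun _ _ => hp _

theorem le_marg₂ {α β : Type*} [Fintype α] {p : α × β → ℝ} (hp : ∀ x, 0 ≤ p x) (x : α × β) :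
    p x ≤ marg₂ p x.2 :=
  Finset.single_le_sum (f := fun a => p (a, x.2)) (fun _ _ => hp _) (Finset.mem_univ x.1)

theorem marg₁_nonneg {α β : Type*} [Fintype β] {p : α × β → ℝ} (hp : ∀ x, 0 ≤ p x) (a : α) :
    0 ≤ marg₁ p a :=
  Finset.sum_nonneg fun _ _ => hp _

theorem le_marg₁ {α β : Type*} [Fintype β] {p : α × β → ℝ} (hp : ∀ x, 0 ≤ p x) (x : α × β) :
    p x ≤ marg₁ p x.1 :=
  Finset.single_le_sum (f := fun b => p (x.1, b)) (fun _ _ => hp _) (Finset.mem_univ x.2)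

theorem sum_marg₁ {α β : Type*} [Fintype α] [Fintype β] (p : α × β → ℝ) :
    ∑ a, marg₁ p a = ∑ x, p x :=
  (Fintype.sum_prod_type p).symm

theorem sum_marg₂ {α β : Type*} [Fintype α] [Fintype β] (p : α × β → ℝ) :
    ∑ b, marg₂ p b = ∑ x, p x :=
  (Fintype.sum_prod_type_right p).symm

theorem sum_mul_snd {α β : Type*} [Fintype α] [Fintype β] (p : α × β → ℝ) (f : β → ℝ) :
    ∑ x, p x * f x.2 = ∑ b, marg₂ p b * f b := by
  simp [Fintype.sum_prod_type_right, marg₂, Finset.sum_mul]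

theorem sum_mul_fst {α β : Type*} [Fintype α] [Fintype β] (p : α × β → ℝ) (f : α → ℝ) :
    ∑ x, p x * f x.1 = ∑ a, marg₁ p a * f a := by
  simp [Fintype.sum_prod_type, marg₁, Finset.sum_mul]

theorem comp_swap_mem_stdSimplex {α β : Type*} [Fintype α] [Fintype β] {p : α × β → ℝ}
    (hp : p ∈ stdSimplex ℝ (α × β)) : p ∘ Prod.swap ∈ stdSimplex ℝ (β × α) :=
  ⟨fun _ => hp.1 _, ((Equiv.prodComm β α).sum_comp p).trans hp.2⟩

theorem sum_prod_pairs {α β : Type*} [Fintype α] [Fintype β] (f : α × β → ℝ) (n : ℕ) :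
    ∑ x : (Fin n → α) × (Fin n → β), ∏ t, f (x.1 t, x.2 t) = (∑ a, f a) ^ n := by
  classical
  rw [← (Equiv.arrowProdEquivProdArrow (Fin n) (fun _ => α) (fun _ => β)).sum_comp,
    Fintype.sum_pow]
  rfl

theorem iidLaw_mem_stdSimplex {α β : Type*} [Fintype α] [Fintype β] {p : α × β → ℝ}
    (hp : p ∈ stdSimplex ℝ (α × β)) (n : ℕ) :
    iidLaw p n ∈ stdSimplex ℝ ((Fin n → α) × (Fin n → β)) :=
  ⟨fun _ => Finset.prod_nonneg fun _ _ => hp.1 _, by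
    simp only [iidLaw]; rw [sum_prod_pairs, hp.2, one_pow]⟩

theorem marg₂_iidLaw {α β : Type*} [Fintype α] (p : α × β → ℝ) (n : ℕ) (b : Fin n → β) :
    marg₂ (iidLaw p n) b = ∏ t, marg₂ p (b t) := by
  classical
  simp only [marg₂, iidLaw]
  rw [Finset.prod_univ_sum, Fintype.piFinset_univ]

theorem marg₁_iidLaw {α β : Type*} [Fintype β] (p : α × β → ℝ) (n : ℕ) (a : Fin n → α) :
    marg₁ (iidLaw p n) a = ∏ t, marg₁ p (a t) :=
  marg₂_iidLaw (p ∘ Prod.swap) n a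

/-! ### Gibbs' inequality and entropies -/

/-- Gibbs' inequality for a measure `Q` of arbitrary total mass. -/
theorem sum_mul_log_div_le {ι : Type*} [Fintype ι] {P Q : ι → ℝ} (hP : ∀ i, 0 ≤ P i)
    (hQ : ∀ i, 0 ≤ Q i) (hPQ : ∀ i, 0 < P i → 0 < Q i) :
    ∑ i, P i * Real.log (Q i / P i) ≤ ∑ i, Q i - ∑ i, P i := by
  rw [← Finset.sum_sub_distrib]
  refine Finset.sum_le_sum fun i _ => ?_
  rcases (hP i).eq_or_lt with h | h
  · simp [← h, hQ i]
  · have := mul_le_mul_of_nonneg_left (Real.log_le_sub_one_of_pos (div_pos (hPQ i h) h)) h.le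
    rwa [mul_sub, mul_div_cancel₀ _ h.ne', mul_one] at this

theorem mul_logb_div {x y z : ℝ} (h : x ≠ 0 → y ≠ 0 ∧ z ≠ 0) :
    x * Real.logb 2 (y / z) = x * Real.logb 2 y - x * Real.logb 2 z := by
  by_cases hx : x = 0
  · simp [hx]
  · rw [Real.logb_div (h hx).1 (h hx).2, mul_sub]

theorem condEntropy₁_eq {α β : Type*} [Fintype α] [Fintype β] (p : α × β → ℝ) :
    condEntropy₁ p = -∑ x, p x * Real.logb 2 (p x / marg₂ p x.2) := by
  rw [condEntropy₁, Fintype.sum_prod_type]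

theorem condEntropy₂_eq {α β : Type*} [Fintype α] [Fintype β] (p : α × β → ℝ) :
    condEntropy₂ p = -∑ x, p x * Real.logb 2 (p x / marg₁ p x.1) := by
  rw [condEntropy₂, Fintype.sum_prod_type]

theorem condEntropy₂_eq_swap {α β : Type*} [Fintype α] [Fintype β] (p : α × β → ℝ) :
    condEntropy₂ p = condEntropy₁ (p ∘ Prod.swap) := by
  rw [condEntropy₁, condEntropy₂, Finset.sum_comm]
  rfl

theorem entropy_comp_swap {α β : Type*} [Fintype α] [Fintype β] (p : α × β → ℝ) :
    entropy (p ∘ Prod.swap) = entropy p := by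
  rw [entropy, entropy,
    ← (Equiv.prodComm β α).sum_comp (fun a => p a * Real.logb 2 (p a))]
  rfl

theorem entropy_eq_condEntropy₁_add {α β : Type*} [Fintype α] [Fintype β] {p : α × β → ℝ}
    (hp : ∀ x, 0 ≤ p x) : entropy p = condEntropy₁ p + entropy (marg₂ p) := by
  have h : ∀ x, p x * Real.logb 2 (p x / marg₂ p x.2) =
      p x * Real.logb 2 (p x) - p x * Real.logb 2 (marg₂ p x.2) := fun x =>
    mul_logb_div fun hx =>
      ⟨hx, (((hp x).lt_of_ne' hx).trans_le (le_marg₂ hp x)).ne'⟩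
  rw [condEntropy₁_eq, entropy, entropy, Finset.sum_congr rfl fun x _ => h x,
    Finset.sum_sub_distrib, sum_mul_snd p fun b => Real.logb 2 (marg₂ p b)]
  ring

theorem entropy_eq_condEntropy₂_add {α β : Type*} [Fintype α] [Fintype β] {p : α × β → ℝ}
    (hp : ∀ x, 0 ≤ p x) : entropy p = condEntropy₂ p + entropy (marg₁ p) := by
  rw [← entropy_comp_swap, condEntropy₂_eq_swap,
    entropy_eq_condEntropy₁_add (p := p ∘ Prod.swap) fun x => hp _]
  rfl

theorem entropy_le_add {α β : Type*} [Fintype α] [Fintype β] {p : α × β → ℝ}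
    (hp : p ∈ stdSimplex ℝ (α × β)) : entropy p ≤ entropy (marg₁ p) + entropy (marg₂ p) := by
  have hpos : ∀ x, 0 < p x → 0 < marg₁ p x.1 ∧ 0 < marg₂ p x.2 := fun x hx =>
    ⟨hx.trans_le (le_marg₁ hp.1 x), hx.trans_le (le_marg₂ hp.1 x)⟩
  have hg := sum_mul_log_div_le (P := p) (Q := fun x => marg₁ p x.1 * marg₂ p x.2) hp.1
    (fun x => mul_nonneg (marg₁_nonneg hp.1 _) (marg₂_nonneg hp.1 _))
    (fun x hx => mul_pos (hpos x hx).1 (hpos x hx).2)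
  have hQ : ∑ x : α × β, marg₁ p x.1 * marg₂ p x.2 = 1 := by
    rw [Fintype.sum_prod_type, ← Finset.sum_mul_sum, sum_marg₁, sum_marg₂, hp.2, one_mul]
  rw [hQ, hp.2, sub_self] at hg
  have h : ∀ x, p x * Real.log (marg₁ p x.1 * marg₂ p x.2 / p x) = Real.log 2 *
      (p x * Real.logb 2 (marg₁ p x.1) + p x * Real.logb 2 (marg₂ p x.2)
        - p x * Real.logb 2 (p x)) := by
    intro x
    have h2 : Real.log 2 ≠ 0 := (Real.log_pos one_lt_two).ne'
    rcases (hp.1 x).eq_or_lt with hx | hx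
    · simp [← hx]
    · rw [Real.log_div (mul_pos (hpos x hx).1 (hpos x hx).2).ne' hx.ne',
        Real.log_mul (hpos x hx).1.ne' (hpos x hx).2.ne']
      simp only [Real.logb]
      field_simp
  rw [Finset.sum_congr rfl fun x _ => h x, ← Finset.mul_sum, Finset.sum_sub_distrib,
    Finset.sum_add_distrib, sum_mul_fst p fun a => Real.logb 2 (marg₁ p a),
    sum_mul_snd p fun b => Real.logb 2 (marg₂ p b)] at hg
  have := nonpos_of_mul_nonpos_right hg (Real.log_pos one_lt_two)
  simp only [entropy]
  linarith

theorem condEntropy₁_nonneg {α β : Type*} [Fintype α] [Fintype β] {p : α × β → ℝ}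
    (hp : ∀ x, 0 ≤ p x) : 0 ≤ condEntropy₁ p := by
  rw [condEntropy₁_eq, neg_nonneg]
  refine Finset.sum_nonpos fun x _ => mul_nonpos_of_nonneg_of_nonpos (hp x) ?_
  exact Real.logb_nonpos one_lt_two (div_nonneg (hp x) (marg₂_nonneg hp _))
    (div_le_one_of_le₀ (le_marg₂ hp x) (marg₂_nonneg hp _))

theorem condEntropy₂_nonneg {α β : Type*} [Fintype α] [Fintype β] {p : α × β → ℝ}
    (hp : ∀ x, 0 ≤ p x) : 0 ≤ condEntropy₂ p := by
  rw [condEntropy₂_eq_swap]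
  exact condEntropy₁_nonneg fun x => hp _

/-! ### Exponential moments of memoryless laws -/

theorem exists_sum_mul_exp_lt_one {ι : Type*} [Fintype ι] {p f : ι → ℝ} (hp : ∑ i, p i = 1)
    (hf : ∑ i, p i * f i < 0) : ∃ s ∈ Set.Ioc (0 : ℝ) 1, ∑ i, p i * Real.exp (s * f i) < 1 := by
  have hd : HasDerivAt (fun s : ℝ => ∑ i, p i * Real.exp (s * f i)) (∑ i, p i * f i) 0 := by
    refine HasDerivAt.fun_sum fun i _ => ?_
    have := (((hasDerivAt_id (0 : ℝ)).mul_const (f i)).exp).const_mul (p i)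
    simpa using this
  have ht := ((hasDerivAt_iff_tendsto_slope.1 hd).mono_left
    (nhdsGT_le_nhdsNE (0 : ℝ))).eventually (gt_mem_nhds hf)
  have h1 : ∀ᶠ s in nhdsWithin (0 : ℝ) (Set.Ioi 0), s ∈ Set.Ioc (0 : ℝ) 1 :=
    Ioc_mem_nhdsGT one_pos
  obtain ⟨s, hs, hs1⟩ := (ht.and h1).exists
  refine ⟨s, hs1, ?_⟩
  rw [slope_def_field] at hs
  have := (div_neg_iff.1 hs).resolve_left (fun h => by linarith [hs1.1, h.2])
  simp [hp] at this
  linarith [this.1]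

theorem log_one_add_le_rpow_div {y s : ℝ} (hy : 0 ≤ y) (hs : s ∈ Set.Ioc (0 : ℝ) 1) :
    Real.log (1 + y) ≤ y ^ s / s := by
  have h1 : (1 + y) ^ s ≤ 1 + y ^ s := by
    simpa using Real.rpow_add_le_add_rpow zero_le_one hy hs.1.le hs.2
  have h2 := Real.log_le_log (Real.rpow_pos_of_pos (by linarith) s) h1
  have h3 := Real.log_le_sub_one_of_pos (by positivity : 0 < 1 + y ^ s)
  rw [Real.log_rpow (by linarith)] at h2
  rw [le_div_iff₀ hs.1]
  linarith

/-- If `log q` has negative mean then the product of `n` independent copies of `q` is exponentially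
small: it is dominated by an exponential moment of small positive order. -/
theorem tendsto_sum_iidLaw_mul_log {α β : Type*} [Fintype α] [Fintype β] {p q : α × β → ℝ}
    (hp : p ∈ stdSimplex ℝ (α × β)) (hq : ∀ x, 0 ≤ q x) (hpq : ∀ x, 0 < p x → 0 < q x)
    (hneg : ∑ x, p x * Real.logb 2 (q x) < 0) :
    Filter.Tendsto (fun n : ℕ => ∑ x : (Fin n → α) × (Fin n → β),
      iidLaw p n x * Real.log (1 + ∏ t, q (x.1 t, x.2 t))) Filter.atTop (nhds 0) := by
  have hneg' : ∑ x, p x * Real.log (q x) < 0 := by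
    have h2 := Real.log_pos one_lt_two
    have : ∑ x, p x * Real.log (q x) = (∑ x, p x * Real.logb 2 (q x)) * Real.log 2 := by
      rw [Finset.sum_mul]
      refine Finset.sum_congr rfl fun x _ => ?_
      rw [Real.logb]
      field_simp
    rw [this]
    exact mul_neg_of_neg_of_pos hneg h2
  obtain ⟨s, hs, hlt⟩ := exists_sum_mul_exp_lt_one hp.2 hneg'
  have hg0 : 0 ≤ ∑ x, p x * Real.exp (s * Real.log (q x)) :=
    Finset.sum_nonneg fun x _ => mul_nonneg (hp.1 x) (Real.exp_pos _).le
  have hlim := (tendsto_pow_atTop_nhds_zero_of_lt_one hg0 hlt).div_const s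
  rw [zero_div] at hlim
  refine squeeze_zero (fun n => ?_) (fun n => ?_) hlim
  · refine Finset.sum_nonneg fun x _ => mul_nonneg ((iidLaw_mem_stdSimplex hp n).1 x)
      (Real.log_nonneg ?_)
    linarith [Finset.prod_nonneg fun t (_ : t ∈ Finset.univ) => hq (x.1 t, x.2 t)]
  · rw [← sum_prod_pairs, Finset.sum_div]
    refine Finset.sum_le_sum fun x _ => ?_
    have hq0 : 0 ≤ ∏ t, q (x.1 t, x.2 t) := Finset.prod_nonneg fun t _ => hq _
    refine (mul_le_mul_of_nonneg_left (log_one_add_le_rpow_div hq0 hs)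
      ((iidLaw_mem_stdSimplex hp n).1 x)).trans_eq ?_
    rw [iidLaw, ← Real.finsetProd_rpow _ _ (fun t _ => hq _), mul_div_assoc',
      ← Finset.prod_mul_distrib]
    congr 1
    refine Finset.prod_congr rfl fun t _ => ?_
    rcases (hp.1 (x.1 t, x.2 t)).eq_or_lt with h | h
    · simp [← h]
    · rw [Real.rpow_def_of_pos (hpq _ h), mul_comm s]

open Classical in
/-- Weak law of large numbers, one-sided, in the form of a bound on the probability that a product
of independent factors is at least one. -/
theorem tendsto_sum_iidLaw_one_le_prod {α β : Type*} [Fintype α] [Fintype β] {p q : α × β → ℝ}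
    (hp : p ∈ stdSimplex ℝ (α × β)) (hq : ∀ x, 0 ≤ q x) (hpq : ∀ x, 0 < p x → 0 < q x)
    (hneg : ∑ x, p x * Real.logb 2 (q x) < 0) :
    Filter.Tendsto (fun n : ℕ => ∑ x : (Fin n → α) × (Fin n → β),
      if 1 ≤ ∏ t, q (x.1 t, x.2 t) then iidLaw p n x else 0) Filter.atTop (nhds 0) := by
  have h2 := Real.log_pos one_lt_two
  have hlim := (tendsto_sum_iidLaw_mul_log hp hq hpq hneg).div_const (Real.log 2)
  rw [zero_div] at hlim
  refine squeeze_zero (fun n => Finset.sum_nonneg fun x _ => ?_) (fun n => ?_) hlim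
  · split_ifs
    exacts [(iidLaw_mem_stdSimplex hp n).1 x, le_rfl]
  · rw [Finset.sum_div]
    refine Finset.sum_le_sum fun x _ => ?_
    have hP := (iidLaw_mem_stdSimplex hp n).1 x
    have hq0 : 0 ≤ ∏ t, q (x.1 t, x.2 t) := Finset.prod_nonneg fun t _ => hq _
    rw [le_div_iff₀ h2]
    split_ifs with h
    · exact mul_le_mul_of_nonneg_left (Real.log_le_log two_pos (by linarith)) hP
    · rw [zero_mul]
      exact mul_nonneg hP (Real.log_nonneg (by linarith))

/-! ### Random binning -/

open Classical in
theorem sum_collision {A : Type*} [Fintype A] (M : ℕ) [NeZero M] (a a' : A) :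
    ∑ φ : A → Fin M, (if φ a' = φ a then (1 : ℝ) else 0) =
      Fintype.card (A → Fin M) * (if a' = a then 1 else 1 / (M : ℝ)) := by
  split_ifs with h
  · simp [h]
  -- Cyclic shifts of the value at `a'` spread the collisions evenly.
  have key : ∀ j : Fin M, ∑ φ : A → Fin M, (if φ a' = φ a then (1 : ℝ) else 0) =
      ∑ φ : A → Fin M, (if φ a' + j = φ a then (1 : ℝ) else 0) := by
    intro j
    rw [← Equiv.sum_comp (Equiv.addRight (Pi.single a' j : A → Fin M))]
    refine Finset.sum_congr rfl fun φ _ => ?_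
    simp [Ne.symm h]
  have hM : (M : ℝ) ≠ 0 := Nat.cast_ne_zero.2 (NeZero.ne M)
  have hsum : (M : ℝ) * ∑ φ : A → Fin M, (if φ a' = φ a then (1 : ℝ) else 0) =
      Fintype.card (A → Fin M) := by
    calc (M : ℝ) * ∑ φ : A → Fin M, (if φ a' = φ a then (1 : ℝ) else 0)
        = ∑ _j : Fin M, ∑ φ : A → Fin M, (if φ a' = φ a then (1 : ℝ) else 0) := by simp
      _ = ∑ φ : A → Fin M, ∑ j : Fin M, (if φ a' + j = φ a then (1 : ℝ) else 0) := by
          rw [Finset.sum_congr rfl fun j _ => key j, Finset.sum_comm]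
      _ = Fintype.card (A → Fin M) := by
          simp_rw [← eq_sub_iff_add_eq']
          simp
  field_simp
  linarith

open Classical in
/-- The mean weight, over independent uniformly random functions `φ₁`, `φ₂`, of the points that fall
into the same bins as `x`. -/
theorem sum_collision_weight_le {A B : Type*} [Fintype A] [Fintype B] (M₁ M₂ : ℕ) [NeZero M₁]
    [NeZero M₂] {w : A × B → ℝ} (hw : ∀ x, 0 ≤ w x) (x : A × B) :
    ∑ φ : (A → Fin M₁) × (B → Fin M₂),
        ∑ x', (if φ.1 x'.1 = φ.1 x.1 ∧ φ.2 x'.2 = φ.2 x.2 then w x' else 0) ≤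
      Fintype.card ((A → Fin M₁) × (B → Fin M₂)) *
        (w x + marg₂ w x.2 / M₁ + marg₁ w x.1 / M₂ + (∑ x', w x') / (M₁ * M₂)) := by
  have hM₁ : (0 : ℝ) < M₁ := Nat.cast_pos.2 (NeZero.pos M₁)
  have hM₂ : (0 : ℝ) < M₂ := Nat.cast_pos.2 (NeZero.pos M₂)
  have h1 : ∀ x' : A × B, ∑ φ : (A → Fin M₁) × (B → Fin M₂),
      (if φ.1 x'.1 = φ.1 x.1 ∧ φ.2 x'.2 = φ.2 x.2 then w x' else 0) =
      Fintype.card ((A → Fin M₁) × (B → Fin M₂)) *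
        (w x' * ((if x'.1 = x.1 then 1 else 1 / (M₁ : ℝ)) *
          (if x'.2 = x.2 then 1 else 1 / (M₂ : ℝ)))) := by
    intro x'
    have : ∀ φ : (A → Fin M₁) × (B → Fin M₂),
        (if φ.1 x'.1 = φ.1 x.1 ∧ φ.2 x'.2 = φ.2 x.2 then w x' else 0) =
        w x' * ((if φ.1 x'.1 = φ.1 x.1 then 1 else 0) *
          (if φ.2 x'.2 = φ.2 x.2 then 1 else 0)) := by
      intro φ
      by_cases ha : φ.1 x'.1 = φ.1 x.1 <;> by_cases hb : φ.2 x'.2 = φ.2 x.2 <;> simp [ha, hb]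
    rw [Finset.sum_congr rfl fun φ _ => this φ, ← Finset.mul_sum, Fintype.sum_prod_type,
      ← Finset.sum_mul_sum (f := fun φ : A → Fin M₁ => if φ x'.1 = φ x.1 then (1 : ℝ) else 0)
        (g := fun φ : B → Fin M₂ => if φ x'.2 = φ x.2 then (1 : ℝ) else 0),
      sum_collision, sum_collision, Fintype.card_prod]
    push_cast
    ring
  rw [Finset.sum_comm, Finset.sum_congr rfl fun x' _ => h1 x', ← Finset.mul_sum]
  refine mul_le_mul_of_nonneg_left ?_ (Nat.cast_nonneg _)
  have e1 : w x = ∑ x', (if x'.1 = x.1 ∧ x'.2 = x.2 then w x' else 0) := by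
    simp [← Prod.ext_iff]
  have e2 : marg₂ w x.2 = ∑ x', (if x'.2 = x.2 then w x' else 0) := by
    simp [Fintype.sum_prod_type, marg₂]
  have e3 : marg₁ w x.1 = ∑ x', (if x'.1 = x.1 then w x' else 0) := by
    simp [Fintype.sum_prod_type_right, marg₁]
  rw [e1, e2, e3, Finset.sum_div, Finset.sum_div, Finset.sum_div, ← Finset.sum_add_distrib,
    ← Finset.sum_add_distrib, ← Finset.sum_add_distrib]
  refine Finset.sum_le_sum fun x' _ => ?_
  have hx := hw x'
  have q1 : 0 ≤ w x' / M₁ := by positivity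
  have q2 : 0 ≤ w x' / M₂ := by positivity
  have q3 : 0 ≤ w x' / (M₁ * M₂) := by positivity
  have q4 : w x' * (1 / (M₁ : ℝ) * (1 / M₂)) = w x' / (M₁ * M₂) := by field_simp
  have q5 : w x' * (1 / (M₁ : ℝ)) = w x' / M₁ := by field_simp
  have q6 : w x' * (1 / (M₂ : ℝ)) = w x' / M₂ := by field_simp
  by_cases ha : x'.1 = x.1 <;> by_cases hb : x'.2 = x.2 <;>
    simp only [ha, hb, if_true, if_false, and_true, and_false, mul_one,
      one_mul, q4, q5, q6, zero_div] <;> linarith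

/-- A set of points whose weights are at least `l` is small when the total weight is at most one. -/
theorem sum_indicator_le_one_div {ι : Type*} [Fintype ι] {q : ι → ℝ} (hq : ∀ i, 0 ≤ q i)
    (hsum : ∑ i, q i ≤ 1) {l : ℝ} (hl : 0 < l) (s : ι → Prop) [DecidablePred s]
    (hs : ∀ i, s i → l ≤ q i) : ∑ i, (if s i then (1 : ℝ) else 0) ≤ 1 / l := by
  rw [le_div_iff₀ hl, Finset.sum_mul]
  refine (Finset.sum_le_sum fun i _ => ?_).trans hsum
  split_ifs with h
  · simpa using hs i h
  · simpa using hq i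

theorem sum_div_marg₂_le_one {A B : Type*} [Fintype A] (P : A × B → ℝ) (b : B) :
    ∑ a, P (a, b) / marg₂ P b ≤ 1 := by
  rw [← Finset.sum_div]
  exact div_self_le_one _

theorem sum_div_marg₁_le_one {A B : Type*} [Fintype B] (P : A × B → ℝ) (a : A) :
    ∑ b, P (a, b) / marg₁ P a ≤ 1 := by
  rw [← Finset.sum_div]
  exact div_self_le_one _

open Classical in
/-- Slepian–Wolf coding of a single pair with law `P` by random binning: the decoder looks for a
point of the set where `P` and its two conditional laws exceed `l₀`, `l₁`, `l₂`. -/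
theorem exists_binning_code {A B : Type*} [Fintype A] [Fintype B] {P : A × B → ℝ}
    (hP : P ∈ stdSimplex ℝ (A × B)) (M₁ M₂ : ℕ) [NeZero M₁] [NeZero M₂] {l₀ l₁ l₂ : ℝ}
    (h₀ : 0 < l₀) (h₁ : 0 < l₁) (h₂ : 0 < l₂) :
    ∃ (φ₁ : A → Fin M₁) (φ₂ : B → Fin M₂) (ψ : Fin M₁ → Fin M₂ → A × B),
      ∑ x, (if ψ (φ₁ x.1) (φ₂ x.2) = x then 0 else P x) ≤
        ∑ x, (if l₀ ≤ P x ∧ l₁ ≤ P x / marg₂ P x.2 ∧ l₂ ≤ P x / marg₁ P x.1 then 0 else P x) +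
          (1 / l₁ / M₁ + 1 / l₂ / M₂ + 1 / l₀ / (M₁ * M₂)) := by
  have hne : Nonempty (A × B) := by
    by_contra h
    have := hP.2
    rw [not_nonempty_iff] at h
    simp at this
  set T : A × B → Prop := fun x =>
    l₀ ≤ P x ∧ l₁ ≤ P x / marg₂ P x.2 ∧ l₂ ≤ P x / marg₁ P x.1 with hT
  let dec : (A → Fin M₁) × (B → Fin M₂) → Fin M₁ → Fin M₂ → A × B := fun φ c₁ c₂ =>
    if h : ∃ x, T x ∧ φ.1 x.1 = c₁ ∧ φ.2 x.2 = c₂ then h.choose else Classical.arbitrary _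
  let w : A × B → A × B → ℝ := fun x x' => if T x' ∧ x' ≠ x then 1 else 0
  have hw : ∀ x x', 0 ≤ w x x' := fun x x' => by simp only [w]; split_ifs <;> norm_num
  have herr : ∀ (φ : (A → Fin M₁) × (B → Fin M₂)) (x : A × B),
      (if dec φ (φ.1 x.1) (φ.2 x.2) = x then 0 else P x) ≤ (if T x then 0 else P x) +
        P x * ∑ x', (if φ.1 x'.1 = φ.1 x.1 ∧ φ.2 x'.2 = φ.2 x.2 then w x x' else 0) := by
    intro φ x
    have hnn : ∀ x', 0 ≤ (if φ.1 x'.1 = φ.1 x.1 ∧ φ.2 x'.2 = φ.2 x.2 then w x x' else 0) := by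
      intro x'; split_ifs
      exacts [hw x x', le_rfl]
    have hsn := Finset.sum_nonneg fun x' (_ : x' ∈ Finset.univ) => hnn x'
    have hPx := hP.1 x
    by_cases hTx : T x
    · rw [if_pos hTx, zero_add]
      split_ifs with hd
      · exact mul_nonneg hPx hsn
      · refine le_mul_of_one_le_right hPx ?_
        have hex : ∃ x', T x' ∧ φ.1 x'.1 = φ.1 x.1 ∧ φ.2 x'.2 = φ.2 x.2 := ⟨x, hTx, rfl, rfl⟩
        have hdec : dec φ (φ.1 x.1) (φ.2 x.2) = hex.choose := dif_pos hex
        have hspec := hex.choose_spec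
        rw [← hdec] at hspec
        refine le_trans ?_ (Finset.single_le_sum (fun x' _ => hnn x')
          (Finset.mem_univ (dec φ (φ.1 x.1) (φ.2 x.2))))
        rw [if_pos hspec.2]
        simp only [w]
        rw [if_pos ⟨hspec.1, hd⟩]
    · rw [if_neg hTx]
      have := mul_nonneg hPx hsn
      split_ifs <;> linarith
  set D : ℝ := 1 / l₁ / M₁ + 1 / l₂ / M₂ + 1 / l₀ / (M₁ * M₂) with hD
  have hmean : ∀ x, ∑ φ : (A → Fin M₁) × (B → Fin M₂),
      ∑ x', (if φ.1 x'.1 = φ.1 x.1 ∧ φ.2 x'.2 = φ.2 x.2 then w x x' else 0) ≤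
      Fintype.card ((A → Fin M₁) × (B → Fin M₂)) * D := by
    intro x
    refine (sum_collision_weight_le M₁ M₂ (hw x) x).trans
      (mul_le_mul_of_nonneg_left ?_ (Nat.cast_nonneg _))
    have hxx : w x x = 0 := by simp [w]
    have b2 : marg₂ (w x) x.2 ≤ 1 / l₁ :=
      sum_indicator_le_one_div (fun a => div_nonneg (hP.1 _) (marg₂_nonneg hP.1 x.2))
        (sum_div_marg₂_le_one P x.2) h₁ _ fun a ha => ha.1.2.1
    have b1 : marg₁ (w x) x.1 ≤ 1 / l₂ :=
      sum_indicator_le_one_div (fun b => div_nonneg (hP.1 _) (marg₁_nonneg hP.1 x.1))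
        (sum_div_marg₁_le_one P x.1) h₂ _ fun a ha => ha.1.2.2
    have b0 : ∑ x', w x x' ≤ 1 / l₀ :=
      sum_indicator_le_one_div hP.1 hP.2.le h₀ _ fun a ha => ha.1.1
    rw [hxx, zero_add, hD]
    gcongr
  obtain ⟨φ, -, hφ⟩ := Finset.exists_le_of_sum_le
    (s := (Finset.univ : Finset ((A → Fin M₁) × (B → Fin M₂)))) Finset.univ_nonempty
    (f := fun φ => ∑ x, (if dec φ (φ.1 x.1) (φ.2 x.2) = x then 0 else P x))
    (g := fun _ => ∑ x, (if T x then 0 else P x) + D) (by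
      calc _ ≤ ∑ φ : (A → Fin M₁) × (B → Fin M₂), ∑ x, ((if T x then 0 else P x) +
            P x * ∑ x', (if φ.1 x'.1 = φ.1 x.1 ∧ φ.2 x'.2 = φ.2 x.2 then w x x' else 0)) :=
            Finset.sum_le_sum fun φ _ => Finset.sum_le_sum fun x _ => herr φ x
        _ = ∑ _φ : (A → Fin M₁) × (B → Fin M₂), ∑ x, (if T x then 0 else P x) +
            ∑ x, P x * ∑ φ : (A → Fin M₁) × (B → Fin M₂),
              ∑ x', (if φ.1 x'.1 = φ.1 x.1 ∧ φ.2 x'.2 = φ.2 x.2 then w x x' else 0) := by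
            simp_rw [Finset.sum_add_distrib, Finset.mul_sum]
            congr 1
            exact Finset.sum_comm
        _ ≤ ∑ _φ : (A → Fin M₁) × (B → Fin M₂), ∑ x, (if T x then 0 else P x) +
            ∑ x, P x * (Fintype.card ((A → Fin M₁) × (B → Fin M₂)) * D) := by
            gcongr with x
            · exact hP.1 x
            · exact hmean x
        _ = _ := by
            rw [← Finset.sum_mul, hP.2, one_mul, Finset.sum_add_distrib]
            congr 1
            simp)
  exact ⟨φ.1, φ.2, dec φ, hφ⟩

open Classical in
/-- Random hashing of a correlated pair: the left-hand side is the divergence of the law of the hash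
values from the uniform law. Concavity of the logarithm moves the average over the hash functions
inside. -/
theorem exists_hash {A B : Type*} [Fintype A] [Fintype B] {P : A × B → ℝ}
    (hP : P ∈ stdSimplex ℝ (A × B)) (M₁ M₂ : ℕ) [NeZero M₁] [NeZero M₂] :
    ∃ (κ₁ : A → Fin M₁) (κ₂ : B → Fin M₂),
      ∑ k, P k * Real.log (M₁ * M₂ *
          ∑ k', (if κ₁ k'.1 = κ₁ k.1 ∧ κ₂ k'.2 = κ₂ k.2 then P k' else 0)) ≤
        ∑ k, P k * Real.log (1 + M₁ * M₂ * P k + M₁ * marg₁ P k.1 + M₂ * marg₂ P k.2) := by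
  have hM₁ : (0 : ℝ) < M₁ := Nat.cast_pos.2 (NeZero.pos M₁)
  have hM₂ : (0 : ℝ) < M₂ := Nat.cast_pos.2 (NeZero.pos M₂)
  set Y : (A → Fin M₁) × (B → Fin M₂) → A × B → ℝ := fun κ k => M₁ * M₂ *
    ∑ k', (if κ.1 k'.1 = κ.1 k.1 ∧ κ.2 k'.2 = κ.2 k.2 then P k' else 0) with hY
  set m : A × B → ℝ := fun k => 1 + M₁ * M₂ * P k + M₁ * marg₁ P k.1 + M₂ * marg₂ P k.2 with hm
  have hmpos : ∀ k, 0 < m k := fun k => by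
    have := hP.1 k
    have := marg₁_nonneg hP.1 k.1
    have := marg₂_nonneg hP.1 k.2
    positivity
  have hYm : ∀ k, ∑ κ, Y κ k ≤ Fintype.card ((A → Fin M₁) × (B → Fin M₂)) * m k := by
    intro k
    rw [← Finset.mul_sum]
    refine (mul_le_mul_of_nonneg_left (sum_collision_weight_le M₁ M₂ hP.1 k)
      (by positivity)).trans_eq ?_
    rw [hP.2, hm]
    field_simp
    ring
  have hYpos : ∀ κ k, 0 < P k → 0 < Y κ k := by
    intro κ k hk
    refine mul_pos (mul_pos hM₁ hM₂) (Finset.sum_pos' (fun k' _ => ?_) ⟨k, Finset.mem_univ _, ?_⟩)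
    · split_ifs
      exacts [hP.1 k', le_rfl]
    · simpa using hk
  obtain ⟨κ, -, hκ⟩ := Finset.exists_le_of_sum_le
    (s := (Finset.univ : Finset ((A → Fin M₁) × (B → Fin M₂)))) Finset.univ_nonempty
    (f := fun κ => ∑ k, P k * Real.log (Y κ k))
    (g := fun _ => ∑ k, P k * Real.log (m k)) (by
      rw [Finset.sum_comm, Finset.sum_comm (f := fun _ k => P k * Real.log (m k))]
      refine Finset.sum_le_sum fun k _ => ?_
      rw [← Finset.mul_sum, ← Finset.mul_sum]
      rcases (hP.1 k).eq_or_lt with hk | hk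
      · simp [← hk]
      refine mul_le_mul_of_nonneg_left ?_ hk.le
      have hlog : ∀ κ, Real.log (Y κ k) ≤ Real.log (m k) + (Y κ k / m k - 1) := by
        intro κ
        have := Real.log_le_sub_one_of_pos (div_pos (hYpos κ k hk) (hmpos k))
        rw [Real.log_div (hYpos κ k hk).ne' (hmpos k).ne'] at this
        linarith
      refine (Finset.sum_le_sum fun κ _ => hlog κ).trans ?_
      rw [Finset.sum_add_distrib, Finset.sum_sub_distrib, ← Finset.sum_div]
      have := (div_le_iff₀ (hmpos k)).2 (hYm k)
      simp only [Finset.sum_const, Finset.card_univ, nsmul_eq_mul, mul_one]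
      linarith)
  exact ⟨κ.1, κ.2, hκ⟩

/-! ### Leakage of additive encryption -/

theorem logb_two_eq (x : ℝ) : Real.logb 2 x * Real.log 2 = Real.log x := by
  rw [Real.logb, div_mul_cancel₀ _ (Real.log_pos one_lt_two).ne']

/-- One-time pad with an imperfect key of law `ρ`: the leakage is at most the divergence of the key
from the uniform law. -/
theorem mutualInfo_additive_le {G Ω : Type*} [Fintype G] [AddCommGroup G] [Fintype Ω]
    {PX : Ω → ℝ} (hX : PX ∈ stdSimplex ℝ Ω) {ρ : G → ℝ} (hρ : ρ ∈ stdSimplex ℝ G) (φ : Ω → G) :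
    mutualInfo (fun cx : G × Ω => PX cx.2 * ρ (cx.1 - φ cx.2)) * Real.log 2 ≤
      ∑ g, ρ g * Real.log (Fintype.card G * ρ g) := by
  set J : G × Ω → ℝ := fun cx => PX cx.2 * ρ (cx.1 - φ cx.2) with hJ
  have hJ0 : ∀ x, 0 ≤ J x := fun x => mul_nonneg (hX.1 _) (hρ.1 _)
  have hG : (0 : ℝ) < Fintype.card G := Nat.cast_pos.2 Fintype.card_pos
  have hm2 : ∀ x, marg₂ J x = PX x := by
    intro x
    simp only [marg₂, hJ]
    have hs : ∑ c, ρ (c - φ x) = ∑ c, ρ c := Equiv.sum_comp (Equiv.subRight (φ x)) ρ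
    rw [← Finset.mul_sum, hs, hρ.2, mul_one]
  set Q := marg₁ J with hQ
  have hQ0 : ∀ c, 0 ≤ Q c := fun c => marg₁_nonneg hJ0 c
  have hQ1 : ∑ c, Q c = 1 := by
    rw [hQ, sum_marg₁, ← sum_marg₂]
    simp only [hm2, hX.2]
  have hgibbs : 0 ≤ ∑ c, Q c * Real.log (Fintype.card G * Q c) := by
    have := sum_mul_log_div_le (P := Q) (Q := fun _ => (1 : ℝ) / Fintype.card G) hQ0
      (fun _ => by positivity) (fun _ _ => by positivity)
    rw [hQ1] at this
    have h2 : ∀ c, Q c * Real.log (1 / Fintype.card G / Q c) =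
        -(Q c * Real.log (Fintype.card G * Q c)) := by
      intro c
      rw [div_div, one_div, Real.log_inv, mul_neg]
    rw [Finset.sum_congr rfl fun c _ => h2 c, Finset.sum_neg_distrib] at this
    simp only [Finset.sum_const, Finset.card_univ, nsmul_eq_mul] at this
    rw [mul_one_div_cancel hG.ne'] at this
    linarith
  have hterm : ∀ x : G × Ω, J x * Real.logb 2 (J x / (marg₁ J x.1 * marg₂ J x.2)) * Real.log 2 =
      J x * Real.log (Fintype.card G * ρ (x.1 - φ x.2)) -
        J x * Real.log (Fintype.card G * Q x.1) := by
    intro x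
    rw [mul_assoc, logb_two_eq, hm2]
    rcases (hJ0 x).eq_or_lt with h | h
    · simp [← h]
    have hXx : 0 < PX x.2 := (hX.1 _).lt_of_ne' fun h0 => by simp [hJ, h0] at h
    have hρx : 0 < ρ (x.1 - φ x.2) := (hρ.1 _).lt_of_ne' fun h0 => by simp [hJ, h0] at h
    have hQx : 0 < Q x.1 := h.trans_le (le_marg₁ hJ0 x)
    rw [← mul_sub, ← Real.log_div (by positivity) (by positivity)]
    have hJx : J x = PX x.2 * ρ (x.1 - φ x.2) := rfl
    rw [← hQ, hJx]
    congr 2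
    field_simp
  have hfst : ∑ x : G × Ω, J x * Real.log (Fintype.card G * Q x.1) =
      ∑ c, Q c * Real.log (Fintype.card G * Q c) :=
    sum_mul_fst J fun c => Real.log (Fintype.card G * Q c)
  have hshift : ∑ x : G × Ω, J x * Real.log (Fintype.card G * ρ (x.1 - φ x.2)) =
      ∑ g, ρ g * Real.log (Fintype.card G * ρ g) := by
    rw [Fintype.sum_prod_type_right]
    have : ∀ x, ∑ c, J (c, x) * Real.log (Fintype.card G * ρ (c - φ x)) =
        PX x * ∑ g, ρ g * Real.log (Fintype.card G * ρ g) := by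
      intro x
      rw [← Equiv.sum_comp (Equiv.subRight (φ x)) (fun g => ρ g * Real.log (Fintype.card G * ρ g)),
        Finset.mul_sum]
      exact Finset.sum_congr rfl fun c _ => mul_assoc _ _ _
    rw [Finset.sum_congr rfl fun x _ => this x, ← Finset.sum_mul, hX.2, one_mul]
  rw [mutualInfo, ← Fintype.sum_prod_type'
    (f := fun a b => J (a, b) * Real.logb 2 (J (a, b) / (marg₁ J a * marg₂ J b))), Finset.sum_mul,
    Finset.sum_congr rfl fun x _ => hterm x, Finset.sum_sub_distrib, hfst, hshift]
  linarith

open Classical in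
/-- The leakage when the code words of `φᵢ` are masked additively by the key hashes `κᵢ` is at most
the divergence of the law of the hashes from the uniform law. -/
theorem mutualInfo_masked_le {A B : Type*} [Fintype A] [Fintype B] {PX PK : A × B → ℝ}
    (hX : PX ∈ stdSimplex ℝ (A × B)) (hK : PK ∈ stdSimplex ℝ (A × B)) {M₁ M₂ : ℕ} [NeZero M₁]
    [NeZero M₂] (φ₁ κ₁ : A → Fin M₁) (φ₂ κ₂ : B → Fin M₂) :
    mutualInfo (fun cx : (Fin M₁ × Fin M₂) × (A × B) => ∑ k : A × B,
        if (φ₁ cx.2.1 + κ₁ k.1, φ₂ cx.2.2 + κ₂ k.2) = cx.1 then PX cx.2 * PK k else 0) *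
        Real.log 2 ≤
      ∑ k, PK k * Real.log (M₁ * M₂ *
          ∑ k', (if κ₁ k'.1 = κ₁ k.1 ∧ κ₂ k'.2 = κ₂ k.2 then PK k' else 0)) := by
  set ρ : Fin M₁ × Fin M₂ → ℝ := fun g =>
    ∑ k, if κ₁ k.1 = g.1 ∧ κ₂ k.2 = g.2 then PK k else 0 with hρ
  have hsum : ∀ f : Fin M₁ × Fin M₂ → ℝ,
      ∑ g, ρ g * f g = ∑ k, PK k * f (κ₁ k.1, κ₂ k.2) := by
    intro f
    simp only [hρ, Finset.sum_mul]
    rw [Finset.sum_comm]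
    refine Finset.sum_congr rfl fun k _ => ?_
    rw [Finset.sum_eq_single (κ₁ k.1, κ₂ k.2)]
    · simp
    · intro g _ hg
      rw [if_neg fun h => hg (Prod.ext h.1.symm h.2.symm), zero_mul]
    · simp
  have hρs : ρ ∈ stdSimplex ℝ (Fin M₁ × Fin M₂) := by
    refine ⟨fun g => Finset.sum_nonneg fun k _ => ?_, ?_⟩
    · split_ifs
      exacts [hK.1 k, le_rfl]
    · simpa [hK.2] using hsum fun _ => 1
  have hmain := mutualInfo_additive_le hX hρs fun x => (φ₁ x.1, φ₂ x.2)
  rw [hsum fun g => Real.log (Fintype.card (Fin M₁ × Fin M₂) * ρ g)] at hmain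
  convert hmain using 3
  · funext cx
    simp only [hρ, Finset.mul_sum]
    refine Finset.sum_congr rfl fun k _ => ?_
    simp only [Prod.ext_iff, Prod.fst_sub, Prod.snd_sub, eq_sub_iff_add_eq', mul_ite, mul_zero]
  · simp [hρ]

/-! ### Concentration of information densities -/

theorem sum_mul_logb_rpow_mul {ι : Type*} [Fintype ι] {p L : ι → ℝ} (hp : p ∈ stdSimplex ℝ ι)
    (hpL : ∀ x, 0 < p x → 0 < L x) (h : ℝ) :
    ∑ x, p x * Real.logb 2 ((2 : ℝ) ^ h * L x) = h + ∑ x, p x * Real.logb 2 (L x) := by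
  have h2 : (0 : ℝ) < 2 ^ h := Real.rpow_pos_of_pos two_pos h
  have : ∀ x, p x * Real.logb 2 ((2 : ℝ) ^ h * L x) = p x * h + p x * Real.logb 2 (L x) := by
    intro x
    rcases (hp.1 x).eq_or_lt with hx | hx
    · simp [← hx]
    · rw [Real.logb_mul h2.ne' (hpL x hx).ne', Real.logb_rpow two_pos (by norm_num), mul_add]
  rw [Finset.sum_congr rfl fun x _ => this x, Finset.sum_add_distrib, ← Finset.sum_mul, hp.2,
    one_mul]

theorem prod_const_mul_pairs {α β : Type*} (L : α × β → ℝ) (c : ℝ) {n : ℕ}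
    (x : (Fin n → α) × (Fin n → β)) :
    ∏ t, c * L (x.1 t, x.2 t) = c ^ n * ∏ t, L (x.1 t, x.2 t) := by
  rw [Finset.prod_mul_distrib, Finset.prod_const, Finset.card_univ, Fintype.card_fin]

theorem tendsto_sum_iidLaw_mul_log_pow {α β : Type*} [Fintype α] [Fintype β] {p L : α × β → ℝ}
    (hp : p ∈ stdSimplex ℝ (α × β)) (hL : ∀ x, 0 ≤ L x) (hpL : ∀ x, 0 < p x → 0 < L x) {h : ℝ}
    (hh : h < -∑ x, p x * Real.logb 2 (L x)) :
    Filter.Tendsto (fun n : ℕ => ∑ x : (Fin n → α) × (Fin n → β), iidLaw p n x *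
      Real.log (1 + ((2 : ℝ) ^ h) ^ n * ∏ t, L (x.1 t, x.2 t))) Filter.atTop (nhds 0) := by
  have h2 : (0 : ℝ) < 2 ^ h := Real.rpow_pos_of_pos two_pos h
  have hlim := tendsto_sum_iidLaw_mul_log (q := fun x => (2 : ℝ) ^ h * L x) hp
    (fun x => mul_nonneg h2.le (hL x)) (fun x hx => mul_pos h2 (hpL x hx)) (by
      rw [sum_mul_logb_rpow_mul hp hpL]; linarith)
  simpa only [prod_const_mul_pairs] using hlim

open Classical in
/-- The upper tail of the information density. -/
theorem tendsto_sum_iidLaw_le_prod {α β : Type*} [Fintype α] [Fintype β] {p L : α × β → ℝ}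
    (hp : p ∈ stdSimplex ℝ (α × β)) (hL : ∀ x, 0 ≤ L x) (hpL : ∀ x, 0 < p x → 0 < L x) {h : ℝ}
    (hh : h < -∑ x, p x * Real.logb 2 (L x)) :
    Filter.Tendsto (fun n : ℕ => ∑ x : (Fin n → α) × (Fin n → β),
      if ((2 : ℝ) ^ (-h)) ^ n ≤ ∏ t, L (x.1 t, x.2 t) then iidLaw p n x else 0)
      Filter.atTop (nhds 0) := by
  have h2 : (0 : ℝ) < 2 ^ h := Real.rpow_pos_of_pos two_pos h
  have hlim := tendsto_sum_iidLaw_one_le_prod (q := fun x => (2 : ℝ) ^ h * L x) hp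
    (fun x => mul_nonneg h2.le (hL x)) (fun x hx => mul_pos h2 (hpL x hx)) (by
      rw [sum_mul_logb_rpow_mul hp hpL]; linarith)
  refine hlim.congr fun n => Finset.sum_congr rfl fun x _ => ?_
  refine if_congr ?_ rfl rfl
  rw [prod_const_mul_pairs, Real.rpow_neg two_pos.le, inv_pow, inv_le_iff_one_le_mul₀' (by positivity)]

open Classical in
/-- The lower tail of the information density. Sequences of probability zero are excluded first, as
`L` may vanish on their letters. -/
theorem tendsto_sum_iidLaw_prod_lt {α β : Type*} [Fintype α] [Fintype β] {p L : α × β → ℝ}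
    (hp : p ∈ stdSimplex ℝ (α × β)) (hL : ∀ x, 0 ≤ L x) (hpL : ∀ x, 0 < p x → 0 < L x) {h : ℝ}
    (hh : -∑ x, p x * Real.logb 2 (L x) < h) :
    Filter.Tendsto (fun n : ℕ => ∑ x : (Fin n → α) × (Fin n → β),
      if ∏ t, L (x.1 t, x.2 t) < ((2 : ℝ) ^ (-h)) ^ n then iidLaw p n x else 0)
      Filter.atTop (nhds 0) := by
  have h2 : (0 : ℝ) < 2 ^ (-h) := Real.rpow_pos_of_pos two_pos _
  have hlim := tendsto_sum_iidLaw_one_le_prod (q := fun x => (2 : ℝ) ^ (-h) / L x) hp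
    (fun x => div_nonneg h2.le (hL x)) (fun x hx => div_pos h2 (hpL x hx)) (by
      have : ∀ x, p x * Real.logb 2 ((2 : ℝ) ^ (-h) / L x) =
          p x * -h - p x * Real.logb 2 (L x) := by
        intro x
        rcases (hp.1 x).eq_or_lt with hx | hx
        · simp [← hx]
        · rw [Real.logb_div h2.ne' (hpL x hx).ne', Real.logb_rpow two_pos (by norm_num), mul_sub]
      rw [Finset.sum_congr rfl fun x _ => this x, Finset.sum_sub_distrib, ← Finset.sum_mul, hp.2]
      linarith)
  refine squeeze_zero (fun n => Finset.sum_nonneg fun x _ => ?_)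
    (fun n => Finset.sum_le_sum fun x _ => ?_) hlim
  · split_ifs
    exacts [(iidLaw_mem_stdSimplex hp n).1 x, le_rfl]
  · have hPx := (iidLaw_mem_stdSimplex hp n).1 x
    rcases hPx.eq_or_lt with h0 | h0
    · simp [← h0]
    have hpos : ∀ t, 0 < p (x.1 t, x.2 t) := fun t =>
      (hp.1 _).lt_of_ne' (Finset.prod_ne_zero_iff.1 h0.ne' t (Finset.mem_univ t))
    by_cases hlt : ∏ t, L (x.1 t, x.2 t) < ((2 : ℝ) ^ (-h)) ^ n
    · rw [if_pos hlt, if_pos]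
      rw [Finset.prod_div_distrib, Finset.prod_const, Finset.card_univ, Fintype.card_fin,
        one_le_div (Finset.prod_pos fun t _ => hpL _ (hpos t))]
      exact hlt.le
    · rw [if_neg hlt]
      split_ifs
      exacts [hPx, le_rfl]

theorem iidLaw_div_marg₂ {α β : Type*} [Fintype α] (p : α × β → ℝ) (n : ℕ)
    (x : (Fin n → α) × (Fin n → β)) :
    iidLaw p n x / marg₂ (iidLaw p n) x.2 =
      ∏ t, (fun y : α × β => p y / marg₂ p y.2) (x.1 t, x.2 t) := by
  rw [marg₂_iidLaw, iidLaw, ← Finset.prod_div_distrib]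

theorem iidLaw_div_marg₁ {α β : Type*} [Fintype β] (p : α × β → ℝ) (n : ℕ)
    (x : (Fin n → α) × (Fin n → β)) :
    iidLaw p n x / marg₁ (iidLaw p n) x.1 =
      ∏ t, (fun y : α × β => p y / marg₁ p y.1) (x.1 t, x.2 t) := by
  rw [marg₁_iidLaw, iidLaw, ← Finset.prod_div_distrib]

theorem div_marg₂_pos {α β : Type*} [Fintype α] {p : α × β → ℝ} (hp : ∀ x, 0 ≤ p x) (x : α × β)
    (hx : 0 < p x) : 0 < p x / marg₂ p x.2 :=
  div_pos hx (hx.trans_le (le_marg₂ hp x))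

theorem div_marg₁_pos {α β : Type*} [Fintype β] {p : α × β → ℝ} (hp : ∀ x, 0 ≤ p x) (x : α × β)
    (hx : 0 < p x) : 0 < p x / marg₁ p x.1 :=
  div_pos hx (hx.trans_le (le_marg₁ hp x))

/-! ### Strong converse for the rates -/

open Classical in
theorem sum_mem_le_total {Ω : Type*} [Fintype Ω] {P : Ω → ℝ} (hP : ∀ x, 0 ≤ P x) (D : Ω → Prop)
    {N : ℝ} (hN : ((Finset.univ.filter D).card : ℝ) ≤ N) {l : ℝ} (hl : 0 ≤ l) :
    ∑ x, (if D x then P x else 0) ≤ ∑ x, (if l ≤ P x then P x else 0) + N * l := by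
  have h1 : ∀ x, (if D x then P x else 0) ≤
      (if l ≤ P x then P x else 0) + (if D x then l else 0) := by
    intro x
    have := hP x
    split_ifs <;> linarith
  refine (Finset.sum_le_sum fun x _ => h1 x).trans ?_
  rw [Finset.sum_add_distrib, ← Finset.sum_filter D, Finset.sum_const, nsmul_eq_mul]
  gcongr

open Classical in
/-- The conditional form of `sum_mem_le_total`: outside the first event, each of the at most `N`
points in the fiber over `b` has mass at most `l` times that of the fiber. -/
theorem sum_mem_le_fiber {A B : Type*} [Fintype A] [Fintype B] {P : A × B → ℝ}
    (hP : P ∈ stdSimplex ℝ (A × B)) (D : A × B → Prop) {N : ℝ}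
    (hN : ∀ b, ((Finset.univ.filter fun a => D (a, b)).card : ℝ) ≤ N) {l : ℝ} (hl : 0 ≤ l) :
    ∑ x, (if D x then P x else 0) ≤
      ∑ x, (if l ≤ P x / marg₂ P x.2 then P x else 0) + N * l := by
  have h1 : ∀ x : A × B, (if D x then P x else 0) ≤
      (if l ≤ P x / marg₂ P x.2 then P x else 0) + (if D x then l * marg₂ P x.2 else 0) := by
    intro x
    have h0 := hP.1 x
    have hm := marg₂_nonneg hP.1 x.2
    have hlm := mul_nonneg hl hm
    by_cases hlx : l ≤ P x / marg₂ P x.2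
    · rw [if_pos hlx]
      split_ifs <;> linarith
    · have : P x ≤ l * marg₂ P x.2 := by
        rcases h0.eq_or_lt with h | h
        · rw [← h]; exact hlm
        · exact (div_le_iff₀ (h.trans_le (le_marg₂ hP.1 x))).1 (not_le.1 hlx).le
      rw [if_neg hlx]
      split_ifs <;> linarith
  refine (Finset.sum_le_sum fun x _ => h1 x).trans ?_
  rw [Finset.sum_add_distrib]
  refine add_le_add le_rfl ?_
  rw [Fintype.sum_prod_type_right]
  calc ∑ b, ∑ a, (if D (a, b) then l * marg₂ P b else 0)
      ≤ ∑ b, N * l * marg₂ P b := by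
        refine Finset.sum_le_sum fun b _ => ?_
        rw [← Finset.sum_filter (fun a => D (a, b)), Finset.sum_const, nsmul_eq_mul, mul_assoc]
        exact mul_le_mul_of_nonneg_right (hN b) (mul_nonneg hl (marg₂_nonneg hP.1 b))
    _ = N * l := by rw [← Finset.mul_sum, sum_marg₂, hP.2, mul_one]

open Classical in
/-- Common core of the strong converse bounds: `L` is the single-letter law, possibly conditional,
whose information density is compared with the number `N n` of available code words. -/
theorem neg_sum_mul_logb_le_of_counting {α β : Type*} [Fintype α] [Fintype β] {p L : α × β → ℝ}
    (hp : p ∈ stdSimplex ℝ (α × β)) (hL : ∀ x, 0 ≤ L x) (hpL : ∀ x, 0 < p x → 0 < L x)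
    {ε R : ℝ} (hε : ε < 1) {N : ℕ → ℝ}
    (hN : ∀ γ > 0, ∀ᶠ n in Filter.atTop, N n ≤ ((2 : ℝ) ^ (R + γ)) ^ n)
    (hcount : ∀ᶠ n in Filter.atTop, ∀ l : ℝ, 0 ≤ l → 1 - ε ≤
      ∑ x : (Fin n → α) × (Fin n → β),
        (if l ≤ ∏ t, L (x.1 t, x.2 t) then iidLaw p n x else 0) + N n * l) :
    -∑ x, p x * Real.logb 2 (L x) ≤ R := by
  by_contra! hlt
  set H := -∑ x, p x * Real.logb 2 (L x) with hH
  have hγ : 0 < (H - R) / 3 := by linarith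
  have h1 := tendsto_sum_iidLaw_le_prod (h := H - (H - R) / 3) hp hL hpL (by linarith)
  have hbase : (2 : ℝ) ^ (R + (H - R) / 3) * 2 ^ (-(H - (H - R) / 3)) < 1 := by
    rw [← Real.rpow_add two_pos]
    exact Real.rpow_lt_one_of_one_lt_of_neg one_lt_two (by linarith)
  have h2 := tendsto_pow_atTop_nhds_zero_of_lt_one (by positivity) hbase
  have h3 := h1.add h2
  rw [add_zero] at h3
  have : 1 - ε ≤ 0 := by
    refine ge_of_tendsto h3 ?_
    filter_upwards [hN _ hγ, hcount] with n hn hc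
    refine (hc _ (by positivity : (0 : ℝ) ≤ (2 ^ (-(H - (H - R) / 3))) ^ n)).trans ?_
    rw [mul_pow]
    gcongr
  linarith

theorem Cryptosystem.ActsAs.decrypt_eq {X₁ X₂ : Type*} {n : ℕ} {E : Cryptosystem X₁ X₂ n}
    {S : SourceCode X₁ X₂ n} (h : E.ActsAs S) {x : (Fin n → X₁) × (Fin n → X₂)}
    (hx : x ∈ S.correctSet) (k₁ : Fin n → X₁) (k₂ : Fin n → X₂) :
    E.Ψ k₁ k₂ (E.Φ₁ k₁ x.1) (E.Φ₂ k₂ x.2) = x :=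
  (h k₁ k₂ x.1 x.2).trans hx

open Classical in
theorem one_sub_errProb {X₁ X₂ : Type*} [Fintype X₁] [Fintype X₂] {n : ℕ}
    (S : SourceCode X₁ X₂ n) {pX : X₁ × X₂ → ℝ} (hpX : pX ∈ stdSimplex ℝ (X₁ × X₂)) :
    1 - S.errProb pX = ∑ x, if x ∈ S.correctSet then iidLaw pX n x else 0 := by
  rw [← (iidLaw_mem_stdSimplex hpX n).2, SourceCode.errProb, ← Finset.sum_sub_distrib]
  refine Finset.sum_congr rfl fun x _ => ?_
  split_ifs <;> simp

open Classical in
theorem Cryptosystem.ActsAs.card_fiber₁_le {X₁ X₂ : Type*} [Fintype X₁] [Fintype X₂] {n : ℕ}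
    {E : Cryptosystem X₁ X₂ n} {S : SourceCode X₁ X₂ n} (h : E.ActsAs S)
    (k₁ : Fin n → X₁) (k₂ : Fin n → X₂) (b : Fin n → X₂) :
    (Finset.univ.filter fun a => (a, b) ∈ S.correctSet).card ≤ E.N₁ := by
  rw [← Fintype.card_fin E.N₁, ← Finset.card_univ]
  refine Finset.card_le_card_of_injOn (E.Φ₁ k₁) (fun _ _ => Finset.mem_coe.2 (Finset.mem_univ _)) ?_
  intro a ha a' ha' haa
  have h1 := h.decrypt_eq (by simpa using ha : (a, b) ∈ S.correctSet) k₁ k₂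
  have h2 := h.decrypt_eq (by simpa using ha' : (a', b) ∈ S.correctSet) k₁ k₂
  simp only [haa] at h1
  exact (Prod.ext_iff.1 (h1.symm.trans h2)).1

open Classical in
theorem Cryptosystem.ActsAs.card_fiber₂_le {X₁ X₂ : Type*} [Fintype X₁] [Fintype X₂] {n : ℕ}
    {E : Cryptosystem X₁ X₂ n} {S : SourceCode X₁ X₂ n} (h : E.ActsAs S)
    (k₁ : Fin n → X₁) (k₂ : Fin n → X₂) (a : Fin n → X₁) :
    (Finset.univ.filter fun b => (a, b) ∈ S.correctSet).card ≤ E.N₂ := by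
  rw [← Fintype.card_fin E.N₂, ← Finset.card_univ]
  refine Finset.card_le_card_of_injOn (E.Φ₂ k₂) (fun _ _ => Finset.mem_coe.2 (Finset.mem_univ _)) ?_
  intro b hb b' hb' hbb
  have h1 := h.decrypt_eq (by simpa using hb : (a, b) ∈ S.correctSet) k₁ k₂
  have h2 := h.decrypt_eq (by simpa using hb' : (a, b') ∈ S.correctSet) k₁ k₂
  simp only [hbb] at h1
  exact (Prod.ext_iff.1 (h1.symm.trans h2)).2

open Classical in
theorem Cryptosystem.ActsAs.card_correctSet_le {X₁ X₂ : Type*} [Fintype X₁] [Fintype X₂] {n : ℕ}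
    {E : Cryptosystem X₁ X₂ n} {S : SourceCode X₁ X₂ n} (h : E.ActsAs S)
    (k₁ : Fin n → X₁) (k₂ : Fin n → X₂) :
    (Finset.univ.filter fun x => x ∈ S.correctSet).card ≤ E.N₁ * E.N₂ := by
  have hc : E.N₁ * E.N₂ = (Finset.univ : Finset (Fin E.N₁ × Fin E.N₂)).card := by simp
  rw [hc]
  refine Finset.card_le_card_of_injOn (fun x => (E.Φ₁ k₁ x.1, E.Φ₂ k₂ x.2))
    (fun _ _ => Finset.mem_coe.2 (Finset.mem_univ _)) ?_
  intro x hx x' hx' hxx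
  have h1 := h.decrypt_eq (by simpa using hx : x ∈ S.correctSet) k₁ k₂
  have h2 := h.decrypt_eq (by simpa using hx' : x' ∈ S.correctSet) k₁ k₂
  have h3 := Prod.ext_iff.1 hxx
  simp only at h3
  rw [← h1, h3.1, h3.2, h2]

theorem natCast_le_pow_of_logb_le {N n : ℕ} (hN : 0 < N) (hn : 0 < n) {r : ℝ}
    (h : 1 / (n : ℝ) * Real.logb 2 N ≤ r) : (N : ℝ) ≤ ((2 : ℝ) ^ r) ^ n := by
  have hn' : (0 : ℝ) < n := Nat.cast_pos.2 hn
  rw [one_div, inv_mul_le_iff₀ hn', Real.logb_le_iff_le_rpow one_lt_two (Nat.cast_pos.2 hN)] at h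
  rwa [← Real.rpow_mul_natCast two_pos.le, mul_comm r]

theorem nonempty_of_mem_stdSimplex {Ω : Type*} [Fintype Ω] {p : Ω → ℝ}
    (hp : p ∈ stdSimplex ℝ Ω) : Nonempty Ω := by
  by_contra h
  have := hp.2
  rw [not_nonempty_iff] at h
  simp at this

/-- The strong converse for the Slepian–Wolf region: fixing the keys turns the cryptosystem into a
source code. -/
theorem mem_swRegion_of_isReliableSecure {X₁ X₂ : Type*} [Fintype X₁] [Fintype X₂]
    {pX pK : X₁ × X₂ → ℝ} (hpX : pX ∈ stdSimplex ℝ (X₁ × X₂)) {ε δ : ℝ} (hε : ε < 1) {R : ℝ × ℝ}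
    (h : IsReliableSecure pX pK ε δ R) : R ∈ swRegion pX := by
  classical
  obtain ⟨E, S, hES, hasym⟩ := h
  obtain ⟨a₀, b₀⟩ := nonempty_of_mem_stdSimplex hpX
  have hN₁ : ∀ n, 0 < (E n).N₁ := fun n => ((E n).Φ₁ (fun _ => a₀) fun _ => a₀).pos
  have hN₂ : ∀ n, 0 < (E n).N₂ := fun n => ((E n).Φ₂ (fun _ => b₀) fun _ => b₀).pos
  have hb₁ : ∀ γ > 0, ∀ᶠ n in Filter.atTop, ((E n).N₁ : ℝ) ≤ ((2 : ℝ) ^ (R.1 + γ)) ^ n := by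
    intro γ hγ
    obtain ⟨n₀, hn₀⟩ := hasym γ hγ
    filter_upwards [Filter.eventually_ge_atTop n₀, Filter.eventually_gt_atTop 0] with n hn hn1
    exact natCast_le_pow_of_logb_le (hN₁ n) hn1 (hn₀ n hn).1
  have hb₂ : ∀ γ > 0, ∀ᶠ n in Filter.atTop, ((E n).N₂ : ℝ) ≤ ((2 : ℝ) ^ (R.2 + γ)) ^ n := by
    intro γ hγ
    obtain ⟨n₀, hn₀⟩ := hasym γ hγ
    filter_upwards [Filter.eventually_ge_atTop n₀, Filter.eventually_gt_atTop 0] with n hn hn1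
    exact natCast_le_pow_of_logb_le (hN₂ n) hn1 (hn₀ n hn).2.1
  have herr : ∀ᶠ n in Filter.atTop,
      1 - ε ≤ ∑ x, if x ∈ (S n).correctSet then iidLaw pX n x else 0 := by
    obtain ⟨n₀, hn₀⟩ := hasym 1 one_pos
    filter_upwards [Filter.eventually_ge_atTop n₀] with n hn
    rw [← one_sub_errProb (S n) hpX]
    linarith [(hn₀ n hn).2.2.1]
  refine ⟨?_, ?_, ?_⟩
  · rw [condEntropy₁_eq]
    refine neg_sum_mul_logb_le_of_counting (L := fun x => pX x / marg₂ pX x.2) hpX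
      (fun x => div_nonneg (hpX.1 x) (marg₂_nonneg hpX.1 _)) (div_marg₂_pos hpX.1) hε hb₁ ?_
    filter_upwards [herr] with n hn l hl
    refine hn.trans ((sum_mem_le_fiber (iidLaw_mem_stdSimplex hpX n) _ (fun b => Nat.cast_le.2
      ((hES n).card_fiber₁_le (fun _ => a₀) (fun _ => b₀) b)) hl).trans_eq ?_)
    simp only [iidLaw_div_marg₂]
  · have hpX' := comp_swap_mem_stdSimplex hpX
    rw [condEntropy₂_eq_swap, condEntropy₁_eq]
    refine neg_sum_mul_logb_le_of_counting
      (L := fun x => (pX ∘ Prod.swap) x / marg₂ (pX ∘ Prod.swap) x.2) hpX'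
      (fun x => div_nonneg (hpX'.1 x) (marg₂_nonneg hpX'.1 _)) (div_marg₂_pos hpX'.1) hε hb₂ ?_
    filter_upwards [herr] with n hn l hl
    have hsw : ∑ x, (if x ∈ (S n).correctSet then iidLaw pX n x else 0) =
        ∑ x : (Fin n → X₂) × (Fin n → X₁),
          if x.swap ∈ (S n).correctSet then iidLaw (pX ∘ Prod.swap) n x else 0 := by
      rw [← (Equiv.prodComm (Fin n → X₂) (Fin n → X₁)).sum_comp]
      rfl
    rw [hsw] at hn
    refine hn.trans ((sum_mem_le_fiber (iidLaw_mem_stdSimplex hpX' n)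
      (fun x => x.swap ∈ (S n).correctSet) (fun b => Nat.cast_le.2
      ((hES n).card_fiber₂_le (fun _ => a₀) (fun _ => b₀) b)) hl).trans_eq ?_)
    simp only [iidLaw_div_marg₂]
  · refine neg_sum_mul_logb_le_of_counting (L := pX) (N := fun n => (E n).N₁ * (E n).N₂)
      hpX hpX.1 (fun _ => id) hε ?_ ?_
    · intro γ hγ
      filter_upwards [hb₁ _ (half_pos hγ), hb₂ _ (half_pos hγ)] with n h1 h2
      have : (2 : ℝ) ^ (R.1 + R.2 + γ) = 2 ^ (R.1 + γ / 2) * 2 ^ (R.2 + γ / 2) := by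
        rw [← Real.rpow_add two_pos]
        ring_nf
      rw [this, mul_pow]
      gcongr
    · filter_upwards [herr] with n hn l hl
      exact hn.trans (sum_mem_le_total (iidLaw_mem_stdSimplex hpX n).1 _
        (by exact_mod_cast (hES n).card_correctSet_le (fun _ => a₀) (fun _ => b₀)) hl)

/-! ### Strong converse for the keys -/

/-- Change of measure: an event that is likely under the joint law and has probability at most `q`
under the product of the marginals forces the mutual information to be large. -/
theorem sum_mem_mul_log_le_mutualInfo {α β : Type*} [Fintype α] [Fintype β] {J : α × β → ℝ}
    (hJ : J ∈ stdSimplex ℝ (α × β)) (G : α × β → Prop) [DecidablePred G] {q : ℝ}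
    (hq : 0 < q)
    (hG : ∑ x, (if G x then marg₁ J x.1 * marg₂ J x.2 else 0) ≤ q) :
    (∑ x, if G x then J x else 0) * Real.log (1 / q) - 1 ≤ mutualInfo J * Real.log 2 := by
  -- Gibbs' inequality is applied with the product law tilted by the factor `1 / q` on `G`; its total
  -- mass is at most `2`.
  set m : α × β → ℝ := fun x => marg₁ J x.1 * marg₂ J x.2 with hm
  have hm0 : ∀ x, 0 ≤ m x := fun x => mul_nonneg (marg₁_nonneg hJ.1 _) (marg₂_nonneg hJ.1 _)
  have hmpos : ∀ x, 0 < J x → 0 < m x := fun x hx =>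
    mul_pos (hx.trans_le (le_marg₁ hJ.1 x)) (hx.trans_le (le_marg₂ hJ.1 x))
  have hm1 : ∑ x, m x = 1 := by
    rw [Fintype.sum_prod_type, ← Finset.sum_mul_sum, sum_marg₁, sum_marg₂, hJ.2, one_mul]
  have hq1 : 0 < 1 / q := one_div_pos.2 hq
  have hg := sum_mul_log_div_le (P := J) (Q := fun x => m x * if G x then 1 / q else 1) hJ.1
    (fun x => mul_nonneg (hm0 x) (by split_ifs <;> positivity))
    (fun x hx => mul_pos (hmpos x hx) (by split_ifs <;> positivity))
  have hQ : ∑ x, (m x * if G x then 1 / q else 1) ≤ 2 := by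
    calc ∑ x, (m x * if G x then 1 / q else 1)
        ≤ ∑ x, ((if G x then m x else 0) * (1 / q) + m x) := by
          refine Finset.sum_le_sum fun x _ => ?_
          have := hm0 x
          split_ifs <;> linarith
      _ ≤ q * (1 / q) + 1 := by
          rw [Finset.sum_add_distrib, ← Finset.sum_mul, hm1]
          gcongr
      _ = 2 := by rw [mul_one_div_cancel hq.ne']; norm_num
  have hterm : ∀ x, J x * Real.log ((m x * if G x then 1 / q else 1) / J x) =
      (if G x then J x else 0) * Real.log (1 / q) -
        J x * Real.logb 2 (J x / m x) * Real.log 2 := by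
    intro x
    rw [mul_assoc (J x) (Real.logb 2 _), logb_two_eq]
    rcases (hJ.1 x).eq_or_lt with h | h
    · simp [← h]
    rw [Real.log_div h.ne' (hmpos x h).ne', mul_div_right_comm,
      Real.log_mul (div_pos (hmpos x h) h).ne' (by split_ifs <;> positivity),
      Real.log_div (hmpos x h).ne' h.ne']
    split_ifs
    · ring
    · rw [Real.log_one]; ring
  rw [Finset.sum_congr rfl fun x _ => hterm x, Finset.sum_sub_distrib, ← Finset.sum_mul,
    ← Finset.sum_mul, hJ.2] at hg
  rw [mutualInfo, ← Fintype.sum_prod_type'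
    (f := fun a b => J (a, b) * Real.logb 2 (J (a, b) / (marg₁ J a * marg₂ J b)))]
  linarith

open Classical in
theorem sum_jointLaw_mul {X₁ X₂ : Type*} [Fintype X₁] [Fintype X₂] {n : ℕ}
    (E : Cryptosystem X₁ X₂ n) (pX pK : X₁ × X₂ → ℝ)
    (f : (Fin E.N₁ × Fin E.N₂) × ((Fin n → X₁) × (Fin n → X₂)) → ℝ) :
    ∑ y, E.jointLaw pX pK y * f y = ∑ x, ∑ k : (Fin n → X₁) × (Fin n → X₂),
      iidLaw pX n x * iidLaw pK n k * f ((E.Φ₁ k.1 x.1, E.Φ₂ k.2 x.2), x) := by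
  rw [Fintype.sum_prod_type_right]
  refine Finset.sum_congr rfl fun x _ => ?_
  simp only [Cryptosystem.jointLaw, Finset.sum_mul]
  rw [Finset.sum_comm]
  refine Finset.sum_congr rfl fun k _ => ?_
  rw [Finset.sum_eq_single (E.Φ₁ k.1 x.1, E.Φ₂ k.2 x.2)]
  · simp
  · intro c _ hc
    rw [if_neg fun h => hc h.symm, zero_mul]
  · simp

theorem jointLaw_mem_stdSimplex {X₁ X₂ : Type*} [Fintype X₁] [Fintype X₂] {n : ℕ}
    (E : Cryptosystem X₁ X₂ n) {pX pK : X₁ × X₂ → ℝ} (hpX : pX ∈ stdSimplex ℝ (X₁ × X₂))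
    (hpK : pK ∈ stdSimplex ℝ (X₁ × X₂)) : E.jointLaw pX pK ∈ stdSimplex ℝ _ := by
  have hX := iidLaw_mem_stdSimplex hpX n
  have hK := iidLaw_mem_stdSimplex hpK n
  refine ⟨fun y => Finset.sum_nonneg fun k _ => ?_, ?_⟩
  · split_ifs
    exacts [mul_nonneg (hX.1 _) (hK.1 _), le_rfl]
  · have := sum_jointLaw_mul E pX pK fun _ => 1
    simp only [mul_one] at this
    rw [this, ← Finset.sum_mul_sum, hX.2, hK.2, one_mul]

theorem marg₂_jointLaw {X₁ X₂ : Type*} [Fintype X₁] [Fintype X₂] {n : ℕ}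
    (E : Cryptosystem X₁ X₂ n) (pX : X₁ × X₂ → ℝ) {pK : X₁ × X₂ → ℝ}
    (hpK : pK ∈ stdSimplex ℝ (X₁ × X₂)) (x : (Fin n → X₁) × (Fin n → X₂)) :
    marg₂ (E.jointLaw pX pK) x = iidLaw pX n x := by
  simp only [marg₂, Cryptosystem.jointLaw]
  rw [Finset.sum_comm]
  simp [← Finset.mul_sum, (iidLaw_mem_stdSimplex hpK n).2]

open Classical in
/-- A ciphertext and the at most `1 / μ` keys of probability at least `μ` leave at most `1 / μ`
candidates for a correctly decoded source pair. Independent sources would rarely hit such a small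
list, whereas the actual ones do. -/
theorem le_leakage {X₁ X₂ : Type*} [Fintype X₁] [Fintype X₂] {n : ℕ}
    {E : Cryptosystem X₁ X₂ n} {S : SourceCode X₁ X₂ n} (hES : E.ActsAs S) {pX pK : X₁ × X₂ → ℝ}
    (hpX : pX ∈ stdSimplex ℝ (X₁ × X₂)) (hpK : pK ∈ stdSimplex ℝ (X₁ × X₂)) {l μ : ℝ}
    (hl : 0 < l) (hlμ : l ≤ μ) :
    (1 - S.errProb pX - ∑ x, (if l ≤ iidLaw pX n x then iidLaw pX n x else 0) -
      ∑ k, (if iidLaw pK n k < μ then iidLaw pK n k else 0)) * Real.log (μ / l) - 1 ≤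
      E.leakage pX pK * Real.log 2 := by
  have hX := iidLaw_mem_stdSimplex hpX n
  have hK := iidLaw_mem_stdSimplex hpK n
  have hJ := jointLaw_mem_stdSimplex E hpX hpK
  have hμ : 0 < μ := hl.trans_le hlμ
  set G : (Fin E.N₁ × Fin E.N₂) × ((Fin n → X₁) × (Fin n → X₂)) → Prop := fun y =>
    iidLaw pX n y.2 ≤ l ∧ ∃ k : (Fin n → X₁) × (Fin n → X₂),
      μ ≤ iidLaw pK n k ∧ E.Ψ k.1 k.2 y.1.1 y.1.2 = y.2 with hG
  have hprod : ∑ y, (if G y then marg₁ (E.jointLaw pX pK) y.1 * marg₂ (E.jointLaw pX pK) y.2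
      else 0) ≤ l / μ := by
    rw [Fintype.sum_prod_type]
    calc _ ≤ ∑ c, marg₁ (E.jointLaw pX pK) c * (l / μ) := by
          refine Finset.sum_le_sum fun c _ => ?_
          have hQ := marg₁_nonneg hJ.1 c
          calc _ ≤ ∑ x, ∑ k : (Fin n → X₁) × (Fin n → X₂), marg₁ (E.jointLaw pX pK) c * l *
                (if E.Ψ k.1 k.2 c.1 c.2 = x then (if μ ≤ iidLaw pK n k then 1 else 0) else 0) := by
                refine Finset.sum_le_sum fun x _ => ?_
                have hnn : ∀ k : (Fin n → X₁) × (Fin n → X₂), 0 ≤ marg₁ (E.jointLaw pX pK) c * l *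
                    (if E.Ψ k.1 k.2 c.1 c.2 = x then
                      (if μ ≤ iidLaw pK n k then (1 : ℝ) else 0) else 0) := by
                  intro k
                  have := mul_nonneg hQ hl.le
                  split_ifs <;> simp [this]
                split_ifs with hg
                · obtain ⟨hx, k, hk, hkx⟩ := hg
                  refine le_trans ?_ (Finset.single_le_sum (fun k _ => hnn k) (Finset.mem_univ k))
                  simp only at hkx hx
                  rw [if_pos hkx, if_pos hk, mul_one, marg₂_jointLaw E pX hpK]
                  exact mul_le_mul_of_nonneg_left hx hQ
                · exact Finset.sum_nonneg fun k _ => hnn k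
            _ = marg₁ (E.jointLaw pX pK) c * l *
                ∑ k, (if μ ≤ iidLaw pK n k then (1 : ℝ) else 0) := by
                rw [Finset.sum_comm, Finset.mul_sum]
                refine Finset.sum_congr rfl fun k _ => ?_
                rw [← Finset.mul_sum]
                simp
            _ ≤ marg₁ (E.jointLaw pX pK) c * l * (1 / μ) := by
                gcongr
                exact sum_indicator_le_one_div hK.1 hK.2.le hμ _ fun k hk => hk
            _ = _ := by ring
      _ = l / μ := by rw [← Finset.sum_mul, sum_marg₁, hJ.2, one_mul]
  have hmain := sum_mem_mul_log_le_mutualInfo hJ G (div_pos hl hμ) hprod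
  rw [one_div_div] at hmain
  refine le_trans (sub_le_sub_right (mul_le_mul_of_nonneg_right ?_
    (Real.log_nonneg ((one_le_div hl).2 hlμ))) 1) hmain
  have hGsum : ∑ y, (if G y then E.jointLaw pX pK y else 0) =
      ∑ x, ∑ k : (Fin n → X₁) × (Fin n → X₂), iidLaw pX n x * iidLaw pK n k *
        (if G ((E.Φ₁ k.1 x.1, E.Φ₂ k.2 x.2), x) then 1 else 0) := by
    rw [← sum_jointLaw_mul E pX pK fun y => if G y then 1 else 0]
    simp
  have hsplit : 1 - S.errProb pX - ∑ x, (if l ≤ iidLaw pX n x then iidLaw pX n x else 0) -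
      ∑ k, (if iidLaw pK n k < μ then iidLaw pK n k else 0) =
      ∑ x, ∑ k : (Fin n → X₁) × (Fin n → X₂),
        ((if x ∈ S.correctSet then iidLaw pX n x else 0) * iidLaw pK n k -
          (if l ≤ iidLaw pX n x then iidLaw pX n x else 0) * iidLaw pK n k -
          iidLaw pX n x * (if iidLaw pK n k < μ then iidLaw pK n k else 0)) := by
    simp only [Finset.sum_sub_distrib, ← Finset.mul_sum, ← Finset.sum_mul, hK.2, hX.2, mul_one,
      one_mul, one_sub_errProb S hpX]
  rw [hGsum, hsplit]
  refine Finset.sum_le_sum fun x _ => Finset.sum_le_sum fun k _ => ?_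
  have hx0 := hX.1 x
  have hk0 := hK.1 k
  have hxk := mul_nonneg hx0 hk0
  by_cases h1 : x ∈ S.correctSet
  · by_cases h2 : l ≤ iidLaw pX n x
    · have : 0 ≤ iidLaw pX n x * (if iidLaw pK n k < μ then iidLaw pK n k else 0) :=
        mul_nonneg hx0 (by split_ifs <;> simp [hk0])
      have : 0 ≤ iidLaw pX n x * iidLaw pK n k *
          (if G ((E.Φ₁ k.1 x.1, E.Φ₂ k.2 x.2), x) then 1 else 0) :=
        mul_nonneg hxk (by split_ifs <;> simp)
      rw [if_pos h1, if_pos h2]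
      linarith
    · by_cases h3 : iidLaw pK n k < μ
      · have : 0 ≤ iidLaw pX n x * iidLaw pK n k *
            (if G ((E.Φ₁ k.1 x.1, E.Φ₂ k.2 x.2), x) then 1 else 0) :=
          mul_nonneg hxk (by split_ifs <;> simp)
        rw [if_pos h1, if_neg h2, if_pos h3]
        linarith
      · rw [if_pos h1, if_neg h2, if_neg h3, if_pos ⟨(not_le.1 h2).le, k, not_lt.1 h3,
          hES.decrypt_eq h1 k.1 k.2⟩]
        simp
  · have e1 : 0 ≤ (if l ≤ iidLaw pX n x then iidLaw pX n x else 0) * iidLaw pK n k :=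
      mul_nonneg (by split_ifs <;> simp [hx0]) hk0
    have e2 : 0 ≤ iidLaw pX n x * (if iidLaw pK n k < μ then iidLaw pK n k else 0) :=
      mul_nonneg hx0 (by split_ifs <;> simp [hk0])
    have e3 : 0 ≤ iidLaw pX n x * iidLaw pK n k *
        (if G ((E.Φ₁ k.1 x.1, E.Φ₂ k.2 x.2), x) then 1 else 0) :=
      mul_nonneg hxk (by split_ifs <;> simp)
    rw [if_neg h1]
    linarith

/-- Bounded leakage and error probability bounded away from one require keys of at least the entropy
of the sources. -/
theorem entropy_le_of_isReliableSecure {X₁ X₂ : Type*} [Fintype X₁] [Fintype X₂]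
    {pX pK : X₁ × X₂ → ℝ} (hpX : pX ∈ stdSimplex ℝ (X₁ × X₂))
    (hpK : pK ∈ stdSimplex ℝ (X₁ × X₂)) {ε δ : ℝ} (hε : ε < 1) {R : ℝ × ℝ}
    (h : IsReliableSecure pX pK ε δ R) : entropy pX ≤ entropy pK := by
  classical
  by_contra! hlt
  obtain ⟨E, S, hES, hasym⟩ := h
  obtain ⟨n₀, hn₀⟩ := hasym 1 one_pos
  set γ := (entropy pX - entropy pK) / 3 with hγ
  have hγ0 : 0 < γ := by linarith
  have hlogγ : 0 < γ * Real.log 2 := mul_pos hγ0 (Real.log_pos one_lt_two)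
  have h1 := tendsto_sum_iidLaw_le_prod (h := entropy pX - γ) hpX hpX.1 (fun _ => id)
    (by simp only [entropy] at *; linarith)
  have h2 := tendsto_sum_iidLaw_prod_lt (h := entropy pK + γ) hpK hpK.1 (fun _ => id)
    (by simp only [entropy] at *; linarith)
  have hc : 0 < (1 - ε) / 2 := by linarith
  have h12 := h1.add h2
  rw [add_zero] at h12
  have hsmall := h12.eventually (gt_mem_nhds hc)
  have hgrow : Filter.Tendsto (fun n : ℕ => (n : ℝ) * ((1 - ε) / 2 * (γ * Real.log 2)))
      Filter.atTop Filter.atTop :=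
    tendsto_natCast_atTop_atTop.atTop_mul_const (mul_pos hc hlogγ)
  obtain ⟨n, hn, hs, hg⟩ := ((Filter.eventually_ge_atTop n₀).and
    (hsmall.and (hgrow.eventually_gt_atTop (δ * Real.log 2 + 1)))).exists
  obtain ⟨-, -, herr, hleak⟩ := hn₀ n hn
  have hl : (0 : ℝ) < (2 ^ (-(entropy pX - γ))) ^ n := by positivity
  have hquot : ((2 : ℝ) ^ (-(entropy pK + γ))) ^ n / (2 ^ (-(entropy pX - γ))) ^ n =
      ((2 : ℝ) ^ γ) ^ n := by
    rw [← div_pow, ← Real.rpow_sub two_pos]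
    congr 2
    rw [hγ]
    ring
  have hlμ : ((2 : ℝ) ^ (-(entropy pX - γ))) ^ n ≤ (2 ^ (-(entropy pK + γ))) ^ n := by
    rw [← one_le_div hl, hquot]
    exact one_le_pow₀ (Real.one_le_rpow one_le_two hγ0.le)
  have hle := le_leakage (hES n) hpX hpK hl hlμ
  rw [hquot, Real.log_pow, Real.log_rpow two_pos] at hle
  have hle2 := mul_le_mul_of_nonneg_right hleak (Real.log_pos one_lt_two).le
  have hA : (1 - ε) / 2 ≤ 1 - (S n).errProb pX -
      ∑ x, (if (2 ^ (-(entropy pX - γ))) ^ n ≤ iidLaw pX n x then iidLaw pX n x else 0) -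
      ∑ k, (if iidLaw pK n k < (2 ^ (-(entropy pK + γ))) ^ n then iidLaw pK n k else 0) := by
    have : ∑ x, (if (2 ^ (-(entropy pX - γ))) ^ n ≤ iidLaw pX n x then iidLaw pX n x else 0) +
        ∑ k, (if iidLaw pK n k < (2 ^ (-(entropy pK + γ))) ^ n then iidLaw pK n k else 0)
        < (1 - ε) / 2 := hs
    linarith
  have hB := mul_le_mul_of_nonneg_right hA (by positivity : 0 ≤ (n : ℝ) * (γ * Real.log 2))
  have hC : (1 - ε) / 2 * ((n : ℝ) * (γ * Real.log 2)) =
      n * ((1 - ε) / 2 * (γ * Real.log 2)) := by ring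
  linarith

/-! ### Achievability -/

theorem floor_pow_bounds {r : ℝ} (hr : 0 ≤ r) (n : ℕ) :
    0 < ⌊((2 : ℝ) ^ r) ^ n⌋₊ ∧ (⌊((2 : ℝ) ^ r) ^ n⌋₊ : ℝ) ≤ ((2 : ℝ) ^ r) ^ n ∧
      ((2 : ℝ) ^ r) ^ n ≤ 2 * (⌊((2 : ℝ) ^ r) ^ n⌋₊ : ℝ) := by
  have h1 : (1 : ℝ) ≤ ((2 : ℝ) ^ r) ^ n := one_le_pow₀ (Real.one_le_rpow one_le_two hr)
  have hpos : 0 < ⌊((2 : ℝ) ^ r) ^ n⌋₊ := Nat.floor_pos.2 h1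
  refine ⟨hpos, Nat.floor_le (by linarith), ?_⟩
  have h2 := Nat.lt_floor_add_one (((2 : ℝ) ^ r) ^ n)
  have h3 : (1 : ℝ) ≤ (⌊((2 : ℝ) ^ r) ^ n⌋₊ : ℝ) := Nat.one_le_cast.2 hpos
  linarith

theorem logb_le_of_natCast_le_pow {N n : ℕ} (hN : 0 < N) {r : ℝ} (hr : 0 ≤ r)
    (h : (N : ℝ) ≤ ((2 : ℝ) ^ r) ^ n) : 1 / (n : ℝ) * Real.logb 2 N ≤ r := by
  rcases n.eq_zero_or_pos with rfl | hn
  · simpa using hr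
  have hn' : (0 : ℝ) < n := Nat.cast_pos.2 hn
  rw [one_div, inv_mul_le_iff₀ hn', Real.logb_le_iff_le_rpow one_lt_two (Nat.cast_pos.2 hN)]
  rwa [← Real.rpow_mul_natCast two_pos.le, mul_comm r] at h

theorem log_one_add_three_le {a b c : ℝ} (ha : 0 ≤ a) (hb : 0 ≤ b) (hc : 0 ≤ c) :
    Real.log (1 + a + b + c) ≤ Real.log (1 + a) + Real.log (1 + b) + Real.log (1 + c) := by
  rw [← Real.log_mul (by positivity) (by positivity),
    ← Real.log_mul (by positivity) (by positivity)]
  refine Real.log_le_log (by positivity) ?_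
  have : 0 ≤ a * b + a * c + b * c + a * b * c := by positivity
  linarith

theorem tendsto_const_mul_pow_div {h r : ℝ} (hr : h < r) (C : ℝ) :
    Filter.Tendsto (fun n : ℕ => C * (1 / ((2 : ℝ) ^ (-h)) ^ n / ((2 : ℝ) ^ r) ^ n))
      Filter.atTop (nhds 0) := by
  have hb : (2 : ℝ) ^ (h - r) < 1 := Real.rpow_lt_one_of_one_lt_of_neg one_lt_two (by linarith)
  have := (tendsto_pow_atTop_nhds_zero_of_lt_one (by positivity) hb).const_mul C
  rw [mul_zero] at this
  refine this.congr fun n => ?_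
  rw [Real.rpow_sub two_pos, Real.rpow_neg two_pos.le, inv_pow, div_pow, one_div, inv_inv]

/-- Slepian–Wolf codes at rates in the interior of the region. -/
theorem eventually_exists_code {X₁ X₂ : Type*} [Fintype X₁] [Fintype X₂] {p : X₁ × X₂ → ℝ}
    (hp : p ∈ stdSimplex ℝ (X₁ × X₂)) {r₁ r₂ : ℝ} (h₁ : condEntropy₁ p < r₁)
    (h₂ : condEntropy₂ p < r₂) (h₀ : entropy p < r₁ + r₂) {ε : ℝ} (hε : 0 < ε) :
    ∀ᶠ n : ℕ in Filter.atTop, ∃ S : SourceCode X₁ X₂ n,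
      S.M₁ = ⌊((2 : ℝ) ^ r₁) ^ n⌋₊ ∧ S.M₂ = ⌊((2 : ℝ) ^ r₂) ^ n⌋₊ ∧ S.errProb p ≤ ε := by
  classical
  have hr₁ : 0 ≤ r₁ := (condEntropy₁_nonneg hp.1).trans h₁.le
  have hr₂ : 0 ≤ r₂ := (condEntropy₂_nonneg hp.1).trans h₂.le
  obtain ⟨g₁, hg₁, hgr₁⟩ := exists_between h₁
  obtain ⟨g₂, hg₂, hgr₂⟩ := exists_between h₂
  obtain ⟨g₀, hg₀, hgr₀⟩ := exists_between h₀
  have t₀ := tendsto_sum_iidLaw_prod_lt (h := g₀) hp hp.1 (fun _ => id) hg₀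
  have t₁ := tendsto_sum_iidLaw_prod_lt (L := fun x => p x / marg₂ p x.2) (h := g₁) hp
    (fun x => div_nonneg (hp.1 x) (marg₂_nonneg hp.1 _)) (div_marg₂_pos hp.1)
    (by rwa [← condEntropy₁_eq])
  have t₂ := tendsto_sum_iidLaw_prod_lt (L := fun x => p x / marg₁ p x.1) (h := g₂) hp
    (fun x => div_nonneg (hp.1 x) (marg₁_nonneg hp.1 _)) (div_marg₁_pos hp.1)
    (by rwa [← condEntropy₂_eq])
  have u₁ := tendsto_const_mul_pow_div hgr₁ 2
  have u₂ := tendsto_const_mul_pow_div hgr₂ 2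
  have u₀ := tendsto_const_mul_pow_div hgr₀ 4
  have hlim := ((t₀.add t₁).add t₂).add ((u₁.add u₂).add u₀)
  simp only [add_zero] at hlim
  filter_upwards [hlim.eventually (gt_mem_nhds hε)] with n hn
  obtain ⟨pos₁, -, lo₁⟩ := floor_pow_bounds hr₁ n
  obtain ⟨pos₂, -, lo₂⟩ := floor_pow_bounds hr₂ n
  set M₁ := ⌊((2 : ℝ) ^ r₁) ^ n⌋₊
  set M₂ := ⌊((2 : ℝ) ^ r₂) ^ n⌋₊
  have : NeZero M₁ := ⟨pos₁.ne'⟩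
  have : NeZero M₂ := ⟨pos₂.ne'⟩
  have hP := iidLaw_mem_stdSimplex hp n
  obtain ⟨φ₁, φ₂, ψ, hS⟩ := exists_binning_code hP M₁ M₂
    (l₀ := ((2 : ℝ) ^ (-g₀)) ^ n) (l₁ := ((2 : ℝ) ^ (-g₁)) ^ n) (l₂ := ((2 : ℝ) ^ (-g₂)) ^ n)
    (by positivity) (by positivity) (by positivity)
  refine ⟨⟨M₁, M₂, φ₁, φ₂, ψ⟩, rfl, rfl, ?_⟩
  refine le_trans (le_trans (le_of_eq ?_) (hS.trans (add_le_add ?_ ?_))) hn.le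
  · refine Finset.sum_congr rfl fun x _ => ?_
    split_ifs with ha hb hb
    exacts [rfl, absurd ha hb, absurd hb ha, rfl]
  · rw [← Finset.sum_add_distrib, ← Finset.sum_add_distrib]
    refine Finset.sum_le_sum fun x _ => ?_
    have hx := hP.1 x
    rw [iidLaw_div_marg₁, iidLaw_div_marg₂]
    simp only [iidLaw] at hx ⊢
    split_ifs <;> first | linarith | (exfalso; simp_all)
  · have hM₁ : (0 : ℝ) < M₁ := Nat.cast_pos.2 pos₁
    have hM₂ : (0 : ℝ) < M₂ := Nat.cast_pos.2 pos₂
    have hbin : ∀ {l M C x : ℝ}, 0 < l → 0 < M → 0 < x → x ≤ C * M →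
        1 / l / M ≤ C * (1 / l / x) := by
      intro l M C x hl hM hx hxM
      rw [mul_div_assoc', div_le_div_iff₀ hM hx]
      have := mul_le_mul_of_nonneg_left hxM (one_div_pos.2 hl).le
      linarith
    refine add_le_add (add_le_add (hbin (by positivity) hM₁ (by positivity) lo₁)
      (hbin (by positivity) hM₂ (by positivity) lo₂))
      (hbin (by positivity) (mul_pos hM₁ hM₂) (by positivity) ?_)
    rw [Real.rpow_add two_pos, mul_pow]
    calc ((2 : ℝ) ^ r₁) ^ n * (2 ^ r₂) ^ n ≤ (2 * M₁) * (2 * M₂) := by gcongr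
      _ = 4 * (M₁ * M₂) := by ring

open Classical in
/-- Key hashes at rates in the interior of the key region are nearly uniform, even without
normalization by the block length. -/
theorem eventually_exists_hash {X₁ X₂ : Type*} [Fintype X₁] [Fintype X₂] {p : X₁ × X₂ → ℝ}
    (hp : p ∈ stdSimplex ℝ (X₁ × X₂)) {r₁ r₂ : ℝ} (hr₁ : 0 ≤ r₁) (hr₂ : 0 ≤ r₂)
    (h₁ : r₁ < entropy (marg₁ p)) (h₂ : r₂ < entropy (marg₂ p)) (h₀ : r₁ + r₂ < entropy p)
    {δ : ℝ} (hδ : 0 < δ) :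
    ∀ᶠ n : ℕ in Filter.atTop, ∃ (κ₁ : (Fin n → X₁) → Fin ⌊((2 : ℝ) ^ r₁) ^ n⌋₊)
      (κ₂ : (Fin n → X₂) → Fin ⌊((2 : ℝ) ^ r₂) ^ n⌋₊),
      ∑ k, iidLaw p n k * Real.log (⌊((2 : ℝ) ^ r₁) ^ n⌋₊ * ⌊((2 : ℝ) ^ r₂) ^ n⌋₊ *
        ∑ k', (if κ₁ k'.1 = κ₁ k.1 ∧ κ₂ k'.2 = κ₂ k.2 then iidLaw p n k' else 0)) ≤ δ := by
  have t₀ := tendsto_sum_iidLaw_mul_log_pow hp hp.1 (fun _ => id) h₀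
  have t₁ := tendsto_sum_iidLaw_mul_log_pow (L := fun x => marg₁ p x.1) (h := r₁) hp
    (fun x => marg₁_nonneg hp.1 _) (fun x hx => hx.trans_le (le_marg₁ hp.1 x))
    (by rwa [sum_mul_fst p fun a => Real.logb 2 (marg₁ p a)])
  have t₂ := tendsto_sum_iidLaw_mul_log_pow (L := fun x => marg₂ p x.2) (h := r₂) hp
    (fun x => marg₂_nonneg hp.1 _) (fun x hx => hx.trans_le (le_marg₂ hp.1 x))
    (by rwa [sum_mul_snd p fun b => Real.logb 2 (marg₂ p b)])
  have hlim := (t₀.add t₁).add t₂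
  simp only [add_zero] at hlim
  filter_upwards [hlim.eventually (gt_mem_nhds hδ)] with n hn
  obtain ⟨pos₁, hi₁, -⟩ := floor_pow_bounds hr₁ n
  obtain ⟨pos₂, hi₂, -⟩ := floor_pow_bounds hr₂ n
  have : NeZero ⌊((2 : ℝ) ^ r₁) ^ n⌋₊ := ⟨pos₁.ne'⟩
  have : NeZero ⌊((2 : ℝ) ^ r₂) ^ n⌋₊ := ⟨pos₂.ne'⟩
  have hP := iidLaw_mem_stdSimplex hp n
  obtain ⟨κ₁, κ₂, hκ⟩ := exists_hash hP ⌊((2 : ℝ) ^ r₁) ^ n⌋₊ ⌊((2 : ℝ) ^ r₂) ^ n⌋₊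
  refine ⟨κ₁, κ₂, (hκ.trans ?_).trans hn.le⟩
  rw [← Finset.sum_add_distrib, ← Finset.sum_add_distrib]
  refine Finset.sum_le_sum fun k _ => ?_
  rw [← mul_add, ← mul_add]
  have hk := hP.1 k
  have hm₁ := marg₁_nonneg hP.1 k.1
  have hm₂ := marg₂_nonneg hP.1 k.2
  refine mul_le_mul_of_nonneg_left ?_ hk
  have e₀ : ∏ t, p (k.1 t, k.2 t) = iidLaw p n k := rfl
  rw [e₀, ← marg₁_iidLaw, ← marg₂_iidLaw]
  refine le_trans (Real.log_le_log (by positivity) ?_)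
    (log_one_add_three_le (by positivity) (by positivity) (by positivity))
  rw [Real.rpow_add two_pos, mul_pow]
  gcongr

/-- Masking the Slepian–Wolf code words additively by the key hashes. -/
theorem eventually_exists_cryptosystem {X₁ X₂ : Type*} [Fintype X₁] [Fintype X₂]
    {pX pK : X₁ × X₂ → ℝ} (hpX : pX ∈ stdSimplex ℝ (X₁ × X₂))
    (hpK : pK ∈ stdSimplex ℝ (X₁ × X₂)) {r₁ r₂ : ℝ} (hX₁ : condEntropy₁ pX < r₁)
    (hX₂ : condEntropy₂ pX < r₂) (hX : entropy pX < r₁ + r₂) (hK₁ : r₁ < entropy (marg₁ pK))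
    (hK₂ : r₂ < entropy (marg₂ pK)) (hK : r₁ + r₂ < entropy pK) {ε δ : ℝ} (hε : 0 < ε)
    (hδ : 0 < δ) :
    ∀ᶠ n : ℕ in Filter.atTop, ∃ (E : Cryptosystem X₁ X₂ n) (S : SourceCode X₁ X₂ n),
      E.ActsAs S ∧ 1 / (n : ℝ) * Real.logb 2 E.N₁ ≤ r₁ ∧ 1 / (n : ℝ) * Real.logb 2 E.N₂ ≤ r₂ ∧
        S.errProb pX ≤ ε ∧ E.leakage pX pK ≤ δ := by
  classical
  have hr₁ : 0 ≤ r₁ := (condEntropy₁_nonneg hpX.1).trans hX₁.le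
  have hr₂ : 0 ≤ r₂ := (condEntropy₂_nonneg hpX.1).trans hX₂.le
  have h2 := Real.log_pos one_lt_two
  filter_upwards [eventually_exists_code hpX hX₁ hX₂ hX hε,
    eventually_exists_hash hpK hr₁ hr₂ hK₁ hK₂ hK (mul_pos hδ h2)] with n hS hκ
  obtain ⟨pos₁, hi₁, -⟩ := floor_pow_bounds hr₁ n
  obtain ⟨pos₂, hi₂, -⟩ := floor_pow_bounds hr₂ n
  obtain ⟨⟨M₁, M₂, φ₁, φ₂, ψ⟩, h1, h2', herr⟩ := hS
  simp only at h1 h2'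
  subst h1 h2'
  obtain ⟨κ₁, κ₂, hκ⟩ := hκ
  have : NeZero ⌊((2 : ℝ) ^ r₁) ^ n⌋₊ := ⟨pos₁.ne'⟩
  have : NeZero ⌊((2 : ℝ) ^ r₂) ^ n⌋₊ := ⟨pos₂.ne'⟩
  -- Addition is that of `Fin Mᵢ`, the integers modulo `Mᵢ`, so the decoder can subtract the masks.
  refine ⟨⟨_, _, fun k x => φ₁ x + κ₁ k, fun k x => φ₂ x + κ₂ k,
    fun k₁ k₂ c₁ c₂ => ψ (c₁ - κ₁ k₁) (c₂ - κ₂ k₂)⟩, _, ?_,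
    logb_le_of_natCast_le_pow pos₁ hr₁ hi₁, logb_le_of_natCast_le_pow pos₂ hr₂ hi₂, herr, ?_⟩
  · intro k₁ k₂ x₁ x₂
    simp only [add_sub_cancel_right]
  · refine le_of_mul_le_mul_right (le_trans ?_ hκ) h2
    have := mutualInfo_masked_le (iidLaw_mem_stdSimplex hpX n) (iidLaw_mem_stdSimplex hpK n)
      φ₁ κ₁ φ₂ κ₂
    refine le_trans (le_of_eq ?_) this
    congr 2

/-- A diagonal argument: systems whose rates exceed `R` by an arbitrarily small amount combine into
one sequence of systems. -/
theorem isReliableSecure_of_forall {X₁ X₂ : Type*} [Fintype X₁] [Fintype X₂] [Nonempty (X₁ × X₂)]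
    {pX pK : X₁ × X₂ → ℝ} {ε δ : ℝ} {R : ℝ × ℝ}
    (h : ∀ γ > 0, ∀ᶠ n : ℕ in Filter.atTop,
      ∃ (E : Cryptosystem X₁ X₂ n) (S : SourceCode X₁ X₂ n),
        E.ActsAs S ∧ 1 / (n : ℝ) * Real.logb 2 E.N₁ ≤ R.1 + γ ∧
          1 / (n : ℝ) * Real.logb 2 E.N₂ ≤ R.2 + γ ∧ S.errProb pX ≤ ε ∧ E.leakage pX pK ≤ δ) :
    IsReliableSecure pX pK ε δ R := by
  classical
  obtain ⟨a₀, b₀⟩ := ‹Nonempty (X₁ × X₂)›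
  let Good : ℕ → ℕ → Prop := fun j n =>
    ∃ (E : Cryptosystem X₁ X₂ n) (S : SourceCode X₁ X₂ n), E.ActsAs S ∧ (0 < j →
      1 / (n : ℝ) * Real.logb 2 E.N₁ ≤ R.1 + 1 / j ∧ 1 / (n : ℝ) * Real.logb 2 E.N₂ ≤ R.2 + 1 / j ∧
        S.errProb pX ≤ ε ∧ E.leakage pX pK ≤ δ)
  -- The requirements at level `0` are void, so that every block length has a system of some level.
  have hzero : ∀ n, Good 0 n := fun n =>
    ⟨⟨1, 1, fun _ _ => 0, fun _ _ => 0, fun _ _ _ _ => (fun _ => a₀, fun _ => b₀)⟩,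
      ⟨1, 1, fun _ => 0, fun _ => 0, fun _ _ => (fun _ => a₀, fun _ => b₀)⟩,
      fun _ _ _ _ => rfl, fun h0 => absurd h0 (lt_irrefl 0)⟩
  have hgood : ∀ n, Good (Nat.findGreatest (Good · n) n) n := fun n =>
    Nat.findGreatest_spec (P := (Good · n)) (Nat.zero_le n) (hzero n)
  choose E S hES hbound using hgood
  refine ⟨E, S, hES, fun γ hγ => ?_⟩
  obtain ⟨j, hj⟩ := exists_nat_one_div_lt hγ
  have hj1 : (0 : ℝ) < 1 / ((j + 1 : ℕ) : ℝ) := by positivity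
  obtain ⟨n₀, hn₀⟩ := Filter.eventually_atTop.1
    ((h _ hj1).and (Filter.eventually_ge_atTop (j + 1)))
  refine ⟨n₀, fun n hn => ?_⟩
  obtain ⟨⟨E', S', hES', hb'⟩, hjn⟩ := hn₀ n hn
  have hle : j + 1 ≤ Nat.findGreatest (Good · n) n :=
    Nat.le_findGreatest hjn ⟨E', S', hES', fun _ => hb'⟩
  obtain ⟨b1, b2, b3, b4⟩ := hbound n (by omega)
  have hsmall : (1 : ℝ) / (Nat.findGreatest (Good · n) n : ℕ) ≤ γ := by
    refine le_trans (one_div_le_one_div_of_le (by positivity) (Nat.cast_le.2 hle)) ?_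
    push_cast
    exact hj.le
  exact ⟨by linarith, by linarith, b3, b4⟩

/-! ### Geometry of the rate regions -/

/-- A point of the polygon `aᵢ ≤ xᵢ ≤ bᵢ`, `s ≤ x₁ + x₂ ≤ t` is a limit of interior points. -/
theorem exists_interior_point_near {a₁ a₂ b₁ b₂ s t x₁ x₂ γ : ℝ} (h₁ : a₁ < b₁) (h₂ : a₂ < b₂)
    (hst : s < t) (has : a₁ + a₂ ≤ s) (htb : t ≤ b₁ + b₂) (ha₁ : a₁ ≤ x₁) (ha₂ : a₂ ≤ x₂)
    (hs : s ≤ x₁ + x₂) (hb₁ : x₁ ≤ b₁) (hb₂ : x₂ ≤ b₂) (ht : x₁ + x₂ ≤ t) (hγ : 0 < γ) :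
    ∃ r₁ r₂, a₁ < r₁ ∧ a₂ < r₂ ∧ s < r₁ + r₂ ∧ r₁ < b₁ ∧ r₂ < b₂ ∧ r₁ + r₂ < t ∧
      r₁ ≤ x₁ + γ ∧ r₂ ≤ x₂ + γ := by
  -- An interior point on the diagonal of the rectangle, at coordinate sum `(s + t) / 2`.
  obtain ⟨y₁, y₂, hy₁, hy₂, hy₁', hy₂', hys, hyt⟩ : ∃ y₁ y₂ : ℝ, a₁ < y₁ ∧ a₂ < y₂ ∧ y₁ < b₁ ∧
      y₂ < b₂ ∧ s < y₁ + y₂ ∧ y₁ + y₂ < t := by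
    have hw : 0 < b₁ + b₂ - (a₁ + a₂) := by linarith
    set c := ((s + t) / 2 - (a₁ + a₂)) / (b₁ + b₂ - (a₁ + a₂)) with hc
    have hc0 : 0 < c := div_pos (by linarith) hw
    have hc1 : c < 1 := (div_lt_one hw).2 (by linarith)
    have hcw : c * (b₁ + b₂ - (a₁ + a₂)) = (s + t) / 2 - (a₁ + a₂) := div_mul_cancel₀ _ hw.ne'
    refine ⟨a₁ + c * (b₁ - a₁), a₂ + c * (b₂ - a₂), ?_, ?_, ?_, ?_, ?_, ?_⟩ <;> nlinarith
  -- Move from `x` towards the interior point by so small a fraction that coordinates change by `γ`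
  -- at most.
  set u := |y₁ - x₁| + |y₂ - x₂| + γ with hu
  have hu0 : 0 < u := by positivity
  set c := γ / u with hc
  have hc0 : 0 < c := div_pos hγ hu0
  have hc1 : c ≤ 1 := (div_le_one hu0).2 (by
    linarith [abs_nonneg (y₁ - x₁), abs_nonneg (y₂ - x₂)])
  have hcu : c * u = γ := div_mul_cancel₀ _ hu0.ne'
  have hcb : ∀ z, z ≤ u → c * z ≤ γ := fun z hz =>
    (mul_le_mul_of_nonneg_left hz hc0.le).trans_eq hcu
  have hz₁ := hcb (y₁ - x₁) (by linarith [le_abs_self (y₁ - x₁), abs_nonneg (y₂ - x₂)])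
  have hz₂ := hcb (y₂ - x₂) (by linarith [le_abs_self (y₂ - x₂), abs_nonneg (y₁ - x₁)])
  have hconv : ∀ {p q : ℝ}, 0 ≤ p → 0 < q → 0 < p + c * (q - p) := by
    intro p q hp hq
    have e : p + c * (q - p) = (1 - c) * p + c * q := by ring
    rw [e]
    exact add_pos_of_nonneg_of_pos (mul_nonneg (by linarith) hp) (mul_pos hc0 hq)
  refine ⟨x₁ + c * (y₁ - x₁), x₂ + c * (y₂ - x₂), ?_, ?_, ?_, ?_, ?_, ?_, ?_, ?_⟩
  · linarith [hconv (sub_nonneg.2 ha₁) (sub_pos.2 hy₁)]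
  · linarith [hconv (sub_nonneg.2 ha₂) (sub_pos.2 hy₂)]
  · linarith [hconv (sub_nonneg.2 hs) (sub_pos.2 hys)]
  · linarith [hconv (sub_nonneg.2 hb₁) (sub_pos.2 hy₁')]
  · linarith [hconv (sub_nonneg.2 hb₂) (sub_pos.2 hy₂')]
  · linarith [hconv (sub_nonneg.2 ht) (sub_pos.2 hyt)]
  · linarith
  · linarith

/-- A pair of the Slepian–Wolf region dominates a pair on the dominant face, and the latter has
rates at most the entropies of the individual sources. -/
theorem mem_innerRegion_of_mem_swRegion {X₁ X₂ : Type*} [Fintype X₁] [Fintype X₂]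
    {pX pK : X₁ × X₂ → ℝ} (hpX : pX ∈ stdSimplex ℝ (X₁ × X₂))
    (h₁ : entropy (marg₁ pX) ≤ entropy (marg₁ pK)) (h₂ : entropy (marg₂ pX) ≤ entropy (marg₂ pK))
    (h : entropy pX ≤ entropy pK) {R : ℝ × ℝ} (hR : R ∈ swRegion pX) :
    R ∈ innerRegion pX pK := by
  obtain ⟨hR₁, hR₂, hR₀⟩ := hR
  have e₁ := entropy_eq_condEntropy₁_add hpX.1
  have e₂ := entropy_eq_condEntropy₂_add hpX.1
  have e₀ := entropy_le_add hpX
  refine ⟨(min R.1 (entropy (marg₁ pX)), entropy pX - min R.1 (entropy (marg₁ pX))),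
    ⟨⟨?_, ?_, ?_⟩, ?_, ?_, ?_⟩, min_le_left _ _, ?_⟩ <;> simp only <;>
    rcases min_cases R.1 (entropy (marg₁ pX)) with ⟨hm, hle⟩ | ⟨hm, hle⟩ <;> rw [hm] <;> linarith

theorem innerRegion_eq_outerRegion {X₁ X₂ : Type*} [Fintype X₁] [Fintype X₂]
    {pX pK : X₁ × X₂ → ℝ} (hpX : pX ∈ stdSimplex ℝ (X₁ × X₂))
    (h₁ : entropy (marg₁ pX) ≤ entropy (marg₁ pK))
    (h₂ : entropy (marg₂ pX) ≤ entropy (marg₂ pK)) :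
    innerRegion pX pK = outerRegion pX pK := by
  rw [outerRegion]
  split_ifs with hne
  · refine Set.Subset.antisymm ?_ ?_
    · rintro R ⟨R', ⟨-, hs₁, hs₂, hs₀⟩, hR₁, hR₂⟩
      exact ⟨hs₁.trans hR₁, hs₂.trans hR₂, hs₀.trans (add_le_add hR₁ hR₂)⟩
    · obtain ⟨R', hk, hs⟩ := hne
      exact fun R hR => mem_innerRegion_of_mem_swRegion hpX h₁ h₂ (hs.2.2.trans hk.2.2) hR
  · rw [Set.eq_empty_iff_forall_notMem]
    rintro R ⟨R', hR', -⟩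
    exact hne ⟨R', hR'⟩

theorem epsDeltaRegion_subset_outerRegion {X₁ X₂ : Type*} [Fintype X₁] [Fintype X₂]
    {pX pK : X₁ × X₂ → ℝ} (hpX : pX ∈ stdSimplex ℝ (X₁ × X₂))
    (hpK : pK ∈ stdSimplex ℝ (X₁ × X₂)) (h₁ : entropy (marg₁ pX) ≤ entropy (marg₁ pK))
    (h₂ : entropy (marg₂ pX) ≤ entropy (marg₂ pK)) {ε δ : ℝ} (hε : ε < 1) :
    epsDeltaRegion pX pK ε δ ⊆ outerRegion pX pK := by
  intro R hR
  rw [← innerRegion_eq_outerRegion hpX h₁ h₂]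
  exact mem_innerRegion_of_mem_swRegion hpX h₁ h₂ (entropy_le_of_isReliableSecure hpX hpK hε hR)
    (mem_swRegion_of_isReliableSecure hpX hε hR)

theorem innerRegion_subset_epsDeltaRegion {X₁ X₂ : Type*} [Fintype X₁] [Fintype X₂]
    {pX pK : X₁ × X₂ → ℝ} (hpX : pX ∈ stdSimplex ℝ (X₁ × X₂))
    (hpK : pK ∈ stdSimplex ℝ (X₁ × X₂)) (hc₁ : condEntropy₁ pX < entropy (marg₁ pK))
    (hc₂ : condEntropy₂ pX < entropy (marg₂ pK)) (hne : entropy pX ≠ entropy pK) {ε δ : ℝ}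
    (hε : 0 < ε) (hδ : 0 < δ) :
    innerRegion pX pK ⊆ epsDeltaRegion pX pK ε δ := by
  rintro R ⟨R', ⟨⟨hk₁, hk₂, hk₀⟩, hs₁, hs₂, hs₀⟩, hR₁, hR₂⟩
  have := nonempty_of_mem_stdSimplex hpX
  refine isReliableSecure_of_forall fun γ hγ => ?_
  have e₁ := entropy_eq_condEntropy₁_add hpX.1
  have e₂ := entropy_eq_condEntropy₂_add hpX.1
  have e₀ := entropy_le_add hpX
  obtain ⟨r₁, r₂, i₁, i₂, i₃, i₄, i₅, i₆, i₇, i₈⟩ := exists_interior_point_near hc₁ hc₂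
    ((hs₀.trans hk₀).lt_of_ne hne) (by linarith) (entropy_le_add hpK) hs₁ hs₂ hs₀ hk₁ hk₂ hk₀ hγ
  filter_upwards [eventually_exists_cryptosystem hpX hpK i₁ i₂ i₃ i₄ i₅ i₆ hε hδ]
    with n ⟨E, S, hES, hb₁, hb₂, hb⟩
  exact ⟨E, S, hES, by linarith, by linarith, hb⟩

theorem corollary1 {X₁ X₂ : Type*} [Fintype X₁] [Fintype X₂]
    (pX pK : X₁ × X₂ → ℝ)
    (hpX : pX ∈ stdSimplex ℝ (X₁ × X₂)) (hpK : pK ∈ stdSimplex ℝ (X₁ × X₂))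
    (δ₀ : ℝ) (hδ₀ : 0 < δ₀)
    (h₁ : entropy (marg₁ pX) ≤ entropy (marg₁ pK))
    (h₂ : entropy (marg₂ pX) ≤ entropy (marg₂ pK)) :
    (innerRegion pX pK = outerRegion pX pK ∧
      ∀ ε ∈ Set.Ioo (0 : ℝ) 1, ∀ δ ∈ Set.Icc (0 : ℝ) δ₀,
        epsDeltaRegion pX pK ε δ ⊆ outerRegion pX pK) ∧
    (condEntropy₁ pX < entropy (marg₁ pK) → condEntropy₂ pX < entropy (marg₂ pK) →
      entropy pX ≠ entropy pK →
      ∀ ε ∈ Set.Ioo (0 : ℝ) 1, ∀ δ ∈ Set.Ioc (0 : ℝ) δ₀,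
        innerRegion pX pK = reliableSecureRegion pX pK δ₀ ∧
        reliableSecureRegion pX pK δ₀ = epsDeltaRegion pX pK ε δ ∧
        epsDeltaRegion pX pK ε δ = outerRegion pX pK) := by
  have hio := innerRegion_eq_outerRegion hpX h₁ h₂
  refine ⟨⟨hio, fun ε hε δ _ => epsDeltaRegion_subset_outerRegion hpX hpK h₁ h₂ hε.2⟩, ?_⟩
  intro hc₁ hc₂ hne
  have heq : ∀ ε ∈ Set.Ioo (0 : ℝ) 1, ∀ δ ∈ Set.Ioc (0 : ℝ) δ₀,
      epsDeltaRegion pX pK ε δ = innerRegion pX pK := fun ε hε δ hδ =>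
    Set.Subset.antisymm (hio ▸ epsDeltaRegion_subset_outerRegion hpX hpK h₁ h₂ hε.2)
      (innerRegion_subset_epsDeltaRegion hpX hpK hc₁ hc₂ hne hε.1 hδ.1)
  intro ε hε δ hδ
  have hrs : reliableSecureRegion pX pK δ₀ = innerRegion pX pK := by
    refine Set.Subset.antisymm ?_ ?_
    · rw [← heq ε hε δ hδ]
      exact (Set.biInter_subset_of_mem hε).trans (Set.biInter_subset_of_mem hδ)
    · exact Set.subset_iInter₂ fun ε' hε' => Set.subset_iInter₂ fun δ' hδ' =>
        (heq ε' hε' δ' hδ').ge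
  exact ⟨hrs.symm, hrs.trans (heq ε hε δ hδ).symm, (heq ε hε δ hδ).trans hio⟩
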